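/- **Simulating a demand oracle with a valuation oracle.** *Setting.* Let $n \ge 1$ be the number of goods. A valuation is a function $v : \mathbb{Z}^n \to \mathbb{R} \cup \{-\infty\}$ whose effective domain $\{x : v(x) > -\infty\}$ is finite and contained in $\mathbb{Z}^n_{\ge 0}$. For prices $p \in \mathbb{R}^n$ put $u_p(x) = v(x) - p\cdot x$, and let $D_v(p)$ be the set of $x$ in the effective domain that maximise $u_p$. The valuation is *strong substitutes* if, whenever $p \le p'$, $D_v(p) = \{x\}$ and $D_v(p') = \{x'\}$, we have $x'_k \ge x_k$ for all $k$ with $p_k = p'_k$, and $\|x'\|_1 \le \|x\|_1$. A (normalised) bid list $\mathcal{B}$ is a finite set of vectors $b \in \mathbb{Z}^n$ with nonzero weights $w(b) \in \mathbb{Z}$. With $b_0 = p_0 = 0$, bid $b$ demands good $i \in \{0,1,\dots,n\}$ at $p$ if $i$ maximises $b_i - p_i$; the price $p$ is marginal if some bid of $\mathcal{B}$ demands more than one good at $p$. At a non-marginal $p$, $D_{\mathcal{B}}(p)$ consists of the single bundle that contains, for each $b \in \mathcal{B}$, $w(b)$ items of the good demanded by $b$ (nothing if this is the reject good $0$); at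 a marginal $p$, $D_{\mathcal{B}}(p)$ is the set of integral points of the convex hull of the bundles demanded at non-marginal prices arbitrarily close to $p$. We say that $\mathcal{B}$ represents $v$ if $D_v(p) = D_{\mathcal{B}}(p)$ for all $p \in \mathbb{R}^n$. Let $B = |\mathcal{B}|$ and $W = \max_{b \in \mathcal{B}} w(b)$ (with $W = 0$ if $\mathcal{B}$ is empty). An algorithm receives $p$ and may adaptively ask value queries: it names $x \in \mathbb{Z}^n$ and is told $v(x)$. It is given neither $v$ nor $\mathcal{B}$, $B$, $W$. Its cost is the number of value queries. *Steepest ascent* is the following algorithm. Let $\hat u(x_0, x) = u_p(x)$ if $x_0 = -\sum_{i=1}^n x_i$ and $\hat u(x_0,x) = -\infty$ otherwise. Start at $z = 0 \in \mathbb{Z}^{n+1}$ and evaluate $\hat u(z)$. Repeatedly evaluate $\hat u(z + e^i - e^j)$ for all $i \ne j$ in $\{0,\dots,n\}$ (at most one value query each); if the largest of these values exceeds $\hat u(z)$, replace $z$ by the first point (in a fixed order of the pairs $(i,j)$) that attains it; otherwise stop and output the last $n$ coordinates of $z$. *Claim.* There is an absolute constant $C > 0$ such that the following hold for every $n \ge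 1$. 1. For all prices $p \in \mathbb{R}^n$, every strong substitutes valuation $v$ and every bid list $\mathcal{B}$ representing $v$, steepest ascent halts and outputs a bundle in $D_v(p)$; if $\mathcal{B}$ is non-empty, it makes at most $C n^2 B W$ value queries. 2. There is an algorithm that, for all prices $p \in \mathbb{R}^n$, every strong substitutes valuation $v$ and every bid list $\mathcal{B}$ representing $v$, halts and outputs a bundle in $D_v(p)$ after at most $C n^3 \log(2 + BW/n)$ value queries (which is polynomial in $n$, $B$ and $\log W$), and after at most $C n^3 \log(BW/n)$ value queries whenever $BW > n$. -/

import Mathlib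

noncomputable section

namespace SSDemand

/-- A valuation on bundles of `n` goods, as a function `ℤⁿ → ℝ ∪ {-∞}` whose effective domain is
finite and consists of non-negative vectors. -/
structure Valuation (n : ℕ) where
  val : (Fin n → ℤ) → WithBot ℝ
  finite_dom : {x | val x ≠ ⊥}.Finite
  nonneg_dom : ∀ x, val x ≠ ⊥ → 0 ≤ x

/-- The utility at prices `p` of a bundle `x` whose value is `a`, namely `a - p · x`. -/
def utilityOfValue {n : ℕ} (p : Fin n → ℝ) (x : Fin n → ℤ) (a : WithBot ℝ) : WithBot ℝ :=
  a + ((-∑ i, p i * (x i : ℝ) : ℝ) : WithBot ℝ)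

/-- The quasi-linear utility `u(x; p) = v(x) - p · x`. -/
def Valuation.utility {n : ℕ} (v : Valuation n) (p : Fin n → ℝ) (x : Fin n → ℤ) : WithBot ℝ :=
  utilityOfValue p x (v.val x)

/-- The demand correspondence `D_v`: the bundles of the domain that maximise utility at `p`. -/
def Valuation.demand {n : ℕ} (v : Valuation n) (p : Fin n → ℝ) : Set (Fin n → ℤ) :=
  {x | v.val x ≠ ⊥ ∧ ∀ y, v.utility p y ≤ v.utility p x}

/-- Strong substitutes: gross substitutes together with the law of aggregate demand. -/
def Valuation.StrongSubstitutes {n : ℕ} (v : Valuation n) : Prop :=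
  ∀ (p p' : Fin n → ℝ) (x x' : Fin n → ℤ), p ≤ p' → v.demand p = {x} → v.demand p' = {x'} →
    (∀ k, p k = p' k → x k ≤ x' k) ∧ ∑ i, |x' i| ≤ ∑ i, |x i|

/-- A normalised bid list: finitely many integral bid vectors, pairwise distinct, each carrying a
nonzero integer weight. -/
abbrev BidList (n : ℕ) := (Fin n → ℤ) →₀ ℤ

/-- The surplus `b i - p i` of a bid on each good of `{0, 1, …, n}`, where good `0` is the reject
good with `b 0 = p 0 = 0`. -/
def surplus {n : ℕ} (b : Fin n → ℤ) (p : Fin n → ℝ) : Fin (n + 1) → ℝ :=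
  Fin.cons 0 fun i => (b i : ℝ) - p i

/-- The bid `b` demands good `i ∈ {0, 1, …, n}` at prices `p`. -/
def BidDemands {n : ℕ} (b : Fin n → ℤ) (p : Fin n → ℝ) (i : Fin (n + 1)) : Prop :=
  ∀ j, surplus b p j ≤ surplus b p i

namespace BidList

variable {n : ℕ}

/-- Some bid of the list is indifferent between two goods at `p`. -/
def Marginal (B : BidList n) (p : Fin n → ℝ) : Prop :=
  ∃ b ∈ B.support, ∃ i j, i ≠ j ∧ BidDemands b p i ∧ BidDemands b p j

open Classical in
/-- At a non-marginal price, the bundle that holds `w(b)` items of the good demanded by `b`, for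
each bid `b` of the list (nothing if that good is the reject good). -/
def bundle (B : BidList n) (p : Fin n → ℝ) : Fin n → ℤ :=
  fun k => ∑ b ∈ B.support with BidDemands b p k.succ, B b

/-- The bundles demanded at non-marginal prices arbitrarily close to `p`. -/
def nearbyBundles (B : BidList n) (p : Fin n → ℝ) : Set (Fin n → ℤ) :=
  {x | ∀ ε > 0, ∃ q, dist q p < ε ∧ ¬ B.Marginal q ∧ B.bundle q = x}

/-- The discrete convex hull of a set of bundles: the integral points of its convex hull. -/
def discreteHull (X : Set (Fin n → ℤ)) : Set (Fin n → ℤ) :=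
  {x | (fun i => (x i : ℝ)) ∈
    convexHull ℝ ((fun (y : Fin n → ℤ) (i : Fin n) => (y i : ℝ)) '' X)}

open Classical in
/-- The demand correspondence `D_B` of a bid list. -/
def demand (B : BidList n) (p : Fin n → ℝ) : Set (Fin n → ℤ) :=
  if B.Marginal p then discreteHull (B.nearbyBundles p) else {B.bundle p}

/-- The bid list represents the demand correspondence of the valuation. -/
def Represents (B : BidList n) (v : Valuation n) : Prop :=
  ∀ p, v.demand p = B.demand p

/-- The number of bids. -/
def numBids (B : BidList n) : ℕ := B.support.card

/-- The maximum bid weight (`0` for the empty list). -/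
def maxWeight (B : BidList n) : ℤ :=
  if h : B.support.Nonempty then B.support.sup' h B else 0

end BidList

/-- One step of an algorithm with access to a valuation oracle: ask for the value of a bundle and
continue from a state that depends on the answer, move on without a query, or halt with an output
bundle. -/
inductive Action (n : ℕ) (State : Type) where
  | ask (x : Fin n → ℤ) (k : WithBot ℝ → State)
  | compute (s : State)
  | halt (x : Fin n → ℤ)

/-- A deterministic adaptive algorithm whose input is a price vector for `n` goods and which
accesses a valuation only through value queries. -/
structure Algorithm (n : ℕ) where
  State : Type
  init : (Fin n → ℝ) → State
  step : State → Action n State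

/-- `A.HaltsFrom v s m x`: with valuation oracle `v`, the algorithm started in state `s` halts with
output `x` after exactly `m` value queries. -/
inductive Algorithm.HaltsFrom {n : ℕ} (A : Algorithm n) (v : Valuation n) :
    A.State → ℕ → (Fin n → ℤ) → Prop where
  | ask {s : A.State} {q : Fin n → ℤ} {k : WithBot ℝ → A.State} {m : ℕ} {x : Fin n → ℤ}
      (h : A.step s = Action.ask q k) (hk : HaltsFrom A v (k (v.val q)) m x) :
      HaltsFrom A v s (m + 1) x
  | compute {s s' : A.State} {m : ℕ} {x : Fin n → ℤ}
      (h : A.step s = Action.compute s') (hk : HaltsFrom A v s' m x) : HaltsFrom A v s m x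
  | halt {s : A.State} {x : Fin n → ℤ} (h : A.step s = Action.halt x) : HaltsFrom A v s 0 x

/-- On input `p` and with valuation oracle `v`, the algorithm halts with output `x` after exactly
`m` value queries. -/
def Algorithm.Halts {n : ℕ} (A : Algorithm n) (v : Valuation n) (p : Fin n → ℝ) (m : ℕ)
    (x : Fin n → ℤ) : Prop :=
  A.HaltsFrom v (A.init p) m x

/-- The M-concave function on `ℤⁿ⁺¹` associated with an M♮-concave function `f` on `ℤⁿ`. -/
def mLift {n : ℕ} (f : (Fin n → ℤ) → WithBot ℝ) (z : Fin (n + 1) → ℤ) : WithBot ℝ :=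
  if z 0 = -∑ i, Fin.tail z i then f (Fin.tail z) else ⊥

/-- Evaluate `mLift (u(·; p))` at `z` with at most one value query and pass the value on. -/
def evalLift {n : ℕ} {State : Type} (p : Fin n → ℝ) (z : Fin (n + 1) → ℤ)
    (k : WithBot ℝ → State) : Action n State :=
  if z 0 = -∑ i, Fin.tail z i then
    Action.ask (Fin.tail z) fun a => k (utilityOfValue p (Fin.tail z) a)
  else Action.compute (k ⊥)

/-- Sanity check for `evalLift`: answering its query from `v` yields `mLift (v.utility p) z`. -/
theorem evalLift_spec {n : ℕ} {State : Type} (v : Valuation n) (p : Fin n → ℝ)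
    (z : Fin (n + 1) → ℤ) (k : WithBot ℝ → State) :
    (match evalLift p z k with
      | Action.ask x k' => k' (v.val x)
      | Action.compute s => s
      | Action.halt _ => k ⊥) = k (mLift (v.utility p) z) := by
  unfold evalLift mLift Valuation.utility
  by_cases h : z 0 = -∑ i, Fin.tail z i <;> simp [h]

/-- States of the steepest ascent algorithm: a start state that remembers the prices, and states
in which the neighbours `current + eⁱ - eʲ` of the current point, for the pairs `(i, j)` on the list
`todo`, still have to be evaluated, while `best` is the best point found so far. -/
inductive AscentState (n : ℕ) where
  | start (p : Fin n → ℝ)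
  | scan (p : Fin n → ℝ) (current : Fin (n + 1) → ℤ) (currentVal : WithBot ℝ)
      (todo : List (Fin (n + 1) × Fin (n + 1)))
      (best : Fin (n + 1) → ℤ) (bestVal : WithBot ℝ)

/-- All ordered pairs of distinct elements of `{0, 1, …, n}`. -/
def exchangePairs (n : ℕ) : List (Fin (n + 1) × Fin (n + 1)) :=
  ((List.finRange (n + 1)) ×ˢ (List.finRange (n + 1))).filter fun ij => ij.1 ≠ ij.2

/-- One step of steepest ascent for `mLift (u(·; p))`: evaluate the next neighbour; when all
neighbours of the current point are evaluated, move to the best one if it is strictly better than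
the current point, and otherwise halt. -/
def ascentStep {n : ℕ} : AscentState n → Action n (AscentState n)
  | .start p => evalLift p 0 fun a => .scan p 0 a (exchangePairs n) 0 a
  | .scan p z a (ij :: rest) best bestVal =>
      let z' := z + Pi.single ij.1 1 - Pi.single ij.2 1
      evalLift p z' fun c =>
        if bestVal < c then .scan p z a rest z' c else .scan p z a rest best bestVal
  | .scan p z a [] best bestVal =>
      if a < bestVal then .compute (.scan p best bestVal (exchangePairs n) best bestVal)
      else .halt (Fin.tail z)

/-- Steepest ascent on the M-concave function associated with the utility, started at the empty
bundle. -/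
def steepestAscent (n : ℕ) : Algorithm n where
  State := AscentState n
  init := AscentState.start
  step := ascentStep

end SSDemand

end

/-! The representing bid list serves two purposes: it shows that `v` is M♮-concave, and it bounds
the size of every bundle of the domain by `B * W`.

Concavity. Give the reject good a price of its own, so that bundles become integral vectors with
coordinate sum zero. Since bids are integral, at an integral price plus perturbations in `[0, 1)`
the demanded goods depend only on the order of the perturbations. So one bundle is demanded
throughout a chamber of prices and, by closedness, at its integral corners
(`exists_chamber_bundle`). Hence the indirect utility is submodular on integral prices, and
Hahn-Banach with a level-set argument separates a bundle outside demand by a unit price cut on a set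
of goods (`integralDemand`). If exchange failed for two bundles, meets and joins of their supporting
prices would contradict submodularity (`IntegralDemand.exchange`).

Steepest ascent. The current point is always best among bundles of its size and strictly better than
all smaller ones. So each move adds one item: at most `B * W` moves, each scanning `O(n²)`
neighbours.

Scaling. Keep a lower bound `l` of some demanded bundle and a step `2 ^ e i` for each good. If one
more item of good `i` is the best improvement of the current point `x`, some demanded bundle has
more than `x i` of it (`exists_demand_gt`); so `l i` rises to `x i + 1` and `x` jumps by a full
step. If no item improves `x`, or the jump leaves the domain, some good `m` is confined to within
`(n + 1) * 2 ^ e m` of `l m`, and its step is halved. A potential of initial size `O(n² (L + 1))`,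
with `2 ^ L` the initial step, drops by one per iteration of `O(n)` queries, and `n * 2 ^ (L + 1) ≤
B * W` unless `B * W < 2 * n`. In that last case unit steps finish in `O(n)` iterations. -/

noncomputable section

namespace SSDemand

/-! ### From demand at integral prices to the exchange property. -/

section Exchange

open Finset

variable {ι : Type*} [Fintype ι]

theorem nonneg_int_induction [DecidableEq ι] {motive : (ι → ℤ) → Prop} (zero : motive 0)
    (step : ∀ q b, 0 ≤ q → motive q → motive (q + Pi.single b 1)) :
    ∀ q, 0 ≤ q → motive q := by
  suffices h : ∀ (N : ℕ) (q : ι → ℤ), 0 ≤ q → ∑ i, q i = N → motive q by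
    intro q hq
    have hs : 0 ≤ ∑ i, q i := Finset.sum_nonneg fun i _ => hq i
    exact h (∑ i, q i).toNat q hq (Int.toNat_of_nonneg hs).symm
  intro N
  induction N with
  | zero =>
    intro q hq hs
    have : q = 0 := by
      ext i
      exact (Finset.sum_eq_zero_iff_of_nonneg fun i _ => hq i).1 (by simpa using hs) i
        (Finset.mem_univ i)
    rwa [this]
  | succ N ih =>
    intro q hq hs
    obtain ⟨b, hb⟩ : ∃ b, 0 < q b := by
      by_contra! hne
      have : ∑ i, q i ≤ 0 := Finset.sum_nonpos fun i _ => hne i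
      push_cast at hs
      omega
    have hq' : 0 ≤ q - Pi.single b 1 := by
      intro j
      by_cases hj : j = b
      · subst hj; simp; omega
      · simpa [hj] using hq j
    have := step (q - Pi.single b 1) b hq' (ih _ hq' (by
      simp only [Pi.sub_apply, Finset.sum_sub_distrib, Finset.sum_pi_single', hs]
      simp))
    simpa using this

/-- A function on the integer lattice that is submodular on unit squares is submodular. -/
theorem submodular_of_local [DecidableEq ι] (f : (ι → ℤ) → ℝ)
    (hloc : ∀ (P : ι → ℤ) (a b : ι), a ≠ b →
      f P + f (P + Pi.single a 1 + Pi.single b 1) ≤ f (P + Pi.single a 1) + f (P + Pi.single b 1))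
    (P Q : ι → ℤ) : f (P ⊓ Q) + f (P ⊔ Q) ≤ f P + f Q := by
  -- The unit-square inequalities are summed along a lattice path in direction `q`; `h2` then does
  -- the same in direction `p`.
  have h1 : ∀ a : ι, ∀ q : ι → ℤ, 0 ≤ q → q a = 0 → ∀ R : ι → ℤ,
      f R + f (R + q + Pi.single a 1) ≤ f (R + Pi.single a 1) + f (R + q) := by
    intro a
    refine nonneg_int_induction ?_ ?_
    · intro _ R; simp [add_comm]
    · intro q b hq ih hqa R
      have hba : a ≠ b := by
        rintro rfl
        have := hq a
        simp at hqa this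
        omega
      have hqa' : q a = 0 := by simpa [hba] using hqa
      have e1 := ih hqa' R
      have e2 := hloc (R + q) a b hba
      have e3 : R + (q + Pi.single b 1) + Pi.single a 1 = R + q + Pi.single a 1 + Pi.single b 1 := by
        abel
      have e4 : R + (q + Pi.single b 1) = R + q + Pi.single b 1 := by abel
      rw [e3, e4]
      linarith
  have h2 : ∀ q : ι → ℤ, 0 ≤ q → ∀ p : ι → ℤ, 0 ≤ p → (∀ i, p i = 0 ∨ q i = 0) → ∀ R : ι → ℤ,
      f R + f (R + q + p) ≤ f (R + p) + f (R + q) := by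
    intro q hq
    refine nonneg_int_induction ?_ ?_
    · intro _ R; simp
    · intro p b hp ih hpq R
      have hqb : q b = 0 := by
        refine (hpq b).resolve_left fun h => ?_
        have := hp b
        simp at h this
        omega
      have hpq' : ∀ i, p i = 0 ∨ q i = 0 := by
        intro i
        by_cases hi : i = b
        · subst hi; exact Or.inr hqb
        · simpa [hi] using hpq i
      have e1 := ih hpq' R
      have e2 := h1 b q hq hqb (R + p)
      have e3 : R + q + (p + Pi.single b 1) = R + p + q + Pi.single b 1 := by abel
      have e4 : R + (p + Pi.single b 1) = R + p + Pi.single b 1 := by abel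
      have e5 : R + q + p = R + p + q := by abel
      rw [e5] at e1
      rw [e3, e4]
      linarith
  have h := h2 (Q - P ⊓ Q) (by intro i; simp) (P - P ⊓ Q) (by intro i; simp) (by
    intro i
    simp only [Pi.sub_apply, Pi.inf_apply]
    rcases le_total (P i) (Q i) with h | h <;> simp [h]) (P ⊓ Q)
  have e1 : P ⊓ Q + (Q - P ⊓ Q) + (P - P ⊓ Q) = P ⊔ Q := by
    ext i
    simp only [Pi.add_apply, Pi.sub_apply, Pi.inf_apply, Pi.sup_apply]
    rcases le_total (P i) (Q i) with h | h <;> simp [h]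
  rw [e1] at h
  simpa using h

/-- The bundle `z` of `S` maximises `g z - P · z` over `S`. -/
def Supports (S : Set (ι → ℤ)) (g : (ι → ℤ) → ℝ) (P z : ι → ℤ) : Prop :=
  z ∈ S ∧ ∀ y ∈ S, g y - ((P ⬝ᵥ y : ℤ) : ℝ) ≤ g z - ((P ⬝ᵥ z : ℤ) : ℝ)

variable {S : Set (ι → ℤ)} {g : (ι → ℤ) → ℝ}

theorem Supports.value_eq {P y z : ι → ℤ} (hy : Supports S g P y) (hz : Supports S g P z) :
    g y - ((P ⬝ᵥ y : ℤ) : ℝ) = g z - ((P ⬝ᵥ z : ℤ) : ℝ) :=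
  le_antisymm (hz.2 _ hy.1) (hy.2 _ hz.1)

theorem Supports.of_le {P y z : ι → ℤ} (hy : Supports S g P y) (hz : z ∈ S)
    (h : g y - ((P ⬝ᵥ y : ℤ) : ℝ) ≤ g z - ((P ⬝ᵥ z : ℤ) : ℝ)) : Supports S g P z :=
  ⟨hz, fun x hx => (hy.2 x hx).trans h⟩

theorem Supports.add_const (hS : ∀ z ∈ S, ∑ i, z i = 0) {P z : ι → ℤ} (h : Supports S g P z)
    (c : ℤ) : Supports S g (P + fun _ => c) z := by
  have key : ∀ y ∈ S, (P + fun _ => c) ⬝ᵥ y = P ⬝ᵥ y := by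
    intro y hy
    have : (fun _ => c : ι → ℤ) ⬝ᵥ y = c * ∑ i, y i := by
      simp [dotProduct, Finset.mul_sum]
    rw [add_dotProduct, this, hS y hy]
    simp
  refine ⟨h.1, fun y hy => ?_⟩
  rw [key y hy, key z h.1]
  exact h.2 y hy

theorem inf_add_sup_dotProduct (P Q z : ι → ℤ) :
    (P ⊓ Q) ⬝ᵥ z + (P ⊔ Q) ⬝ᵥ z = P ⬝ᵥ z + Q ⬝ᵥ z := by
  simp only [dotProduct, ← Finset.sum_add_distrib]
  refine Finset.sum_congr rfl fun i _ => ?_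
  simp only [Pi.inf_apply, Pi.sup_apply]
  rcases le_total (P i) (Q i) with h | h <;> simp [h]; ring

variable [DecidableEq ι]

/-- The indicator vector of a finite set of goods. -/
def ind (A : Finset ι) : ι → ℤ := fun i => if i ∈ A then 1 else 0

theorem ind_dotProduct (A : Finset ι) (z : ι → ℤ) : ind A ⬝ᵥ z = ∑ i ∈ A, z i := by
  simp [ind, dotProduct, Finset.sum_ite_mem]

/-- The two facts on the demand at integral prices from which the exchange property follows:
neighbouring prices on a unit square share a demanded bundle, and a bundle that is not demanded is
separated from the demanded ones by an integral change of prices. -/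
structure IntegralDemand (S : Set (ι → ℤ)) (g : (ι → ℤ) → ℝ) : Prop where
  sum_eq_zero : ∀ z ∈ S, ∑ i, z i = 0
  exists_supports : ∀ P, ∃ y, Supports S g P y
  square : ∀ (P : ι → ℤ) (a b : ι), a ≠ b →
    ∃ y, Supports S g P y ∧ Supports S g (P + Pi.single a 1 + Pi.single b 1) y
  separate : ∀ (P t : ι → ℤ), ∑ i, t i = 0 → ¬ Supports S g P t →
    ∃ (A : Finset ι) (y : ι → ℤ), Supports S g P y ∧ Supports S g (P - ind A) y ∧
      ∑ i ∈ A, y i < ∑ i ∈ A, t i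

namespace IntegralDemand

/-- Opposite corners of a unit square share a maximiser, whose utility bounds the indirect utility
from below at the other two corners. This is local submodularity. -/
theorem submodular (H : IntegralDemand S g) {P Q z w y y' : ι → ℤ} (hz : Supports S g P z)
    (hw : Supports S g Q w) (hy : y ∈ S) (hy' : y' ∈ S) :
    (g y - (((P ⊓ Q) ⬝ᵥ y : ℤ) : ℝ)) + (g y' - (((P ⊔ Q) ⬝ᵥ y' : ℤ) : ℝ)) ≤
      (g z - ((P ⬝ᵥ z : ℤ) : ℝ)) + (g w - ((Q ⬝ᵥ w : ℤ) : ℝ)) := by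
  choose m hm using H.exists_supports
  let f : (ι → ℤ) → ℝ := fun P => g (m P) - ((P ⬝ᵥ m P : ℤ) : ℝ)
  have hf : ∀ {P y}, Supports S g P y → g y - ((P ⬝ᵥ y : ℤ) : ℝ) = f P :=
    fun h => h.value_eq (hm _)
  have hub : ∀ P, ∀ y ∈ S, g y - ((P ⬝ᵥ y : ℤ) : ℝ) ≤ f P := fun P y hy => (hm P).2 y hy
  rw [hf hz, hf hw]
  refine (add_le_add (hub _ _ hy) (hub _ _ hy')).trans ?_
  refine submodular_of_local f (fun P a b hab => ?_) P Q
  obtain ⟨x, hx, hx'⟩ := H.square P a b hab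
  have h1 := hub (P + Pi.single a 1) x hx.1
  have h2 := hub (P + Pi.single b 1) x hx.1
  rw [← hf hx, ← hf hx']
  simp only [add_dotProduct] at h1 h2 ⊢
  push_cast at h1 h2 ⊢
  linarith

/-- The price paid for `z` is modular in the prices, so the optimality gaps of `z` at the meet and
the join add up to at most zero. -/
theorem supports_inf_sup (H : IntegralDemand S g) {P Q z : ι → ℤ} (hP : Supports S g P z)
    (hQ : Supports S g Q z) : Supports S g (P ⊓ Q) z ∧ Supports S g (P ⊔ Q) z := by
  have e : (((P ⊓ Q) ⬝ᵥ z : ℤ) : ℝ) + (((P ⊔ Q) ⬝ᵥ z : ℤ) : ℝ) =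
      ((P ⬝ᵥ z : ℤ) : ℝ) + ((Q ⬝ᵥ z : ℤ) : ℝ) := by
    exact_mod_cast inf_add_sup_dotProduct P Q z
  refine ⟨⟨hP.1, fun y hy => ?_⟩, ⟨hP.1, fun y hy => ?_⟩⟩
  · have := H.submodular hP hQ hy hP.1
    linarith
  · have := H.submodular hP hQ hP.1 hy
    linarith

theorem supports_of_tight {P z y : ι → ℤ} {A : Finset ι} (hz : Supports S g P z)
    (hy : Supports S g P y) (hy' : Supports S g (P - ind A) y)
    (h : ∑ i ∈ A, y i ≤ ∑ i ∈ A, z i) : Supports S g (P - ind A) z := by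
  refine hy'.of_le hz.1 ?_
  have e := hy.value_eq hz
  have h' : ((ind A ⬝ᵥ y : ℤ) : ℝ) ≤ ((ind A ⬝ᵥ z : ℤ) : ℝ) := by
    rw [ind_dotProduct, ind_dotProduct]; exact_mod_cast h
  simp only [sub_dotProduct]
  push_cast
  linarith

/-- Every bundle of the domain is demanded at some integral price. -/
theorem exists_supporting_price (H : IntegralDemand S g) {z : ι → ℤ} (hz : z ∈ S) :
    ∃ P, Supports S g P z := by
  choose m hm using H.exists_supports
  let gap : (ι → ℤ) → ℝ := fun P => g (m P) - ((P ⬝ᵥ m P : ℤ) : ℝ) + ((P ⬝ᵥ z : ℤ) : ℝ) - g z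
  have hgap : ∀ P, 0 ≤ gap P := fun P => by
    have := (hm P).2 z hz
    simp only [gap]; linarith
  by_contra hne
  push Not at hne
  -- The price cut on `A` helps `z` by at least one unit more than `y`, which is optimal before and
  -- after. So the non-negative gap could fall forever.
  have hdec : ∀ P, ∃ Q, gap Q ≤ gap P - 1 := by
    intro P
    obtain ⟨A, y, hy, hy', hlt⟩ := H.separate P z (H.sum_eq_zero z hz) (hne P)
    refine ⟨P - ind A, ?_⟩
    have e1 := hy.value_eq (hm P)
    have e2 := hy'.value_eq (hm (P - ind A))
    have h' : ((ind A ⬝ᵥ y : ℤ) : ℝ) + 1 ≤ ((ind A ⬝ᵥ z : ℤ) : ℝ) := by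
      rw [ind_dotProduct, ind_dotProduct]; exact_mod_cast hlt
    simp only [gap, ← e1, ← e2]
    simp only [sub_dotProduct]
    push_cast
    linarith
  have hall : ∀ N : ℕ, ∃ P, gap P ≤ gap 0 - N := by
    intro N
    induction N with
    | zero => exact ⟨0, by simp⟩
    | succ N ih =>
      obtain ⟨P, hP⟩ := ih
      obtain ⟨Q, hQ⟩ := hdec P
      exact ⟨Q, by push_cast; linarith⟩
  obtain ⟨N, hN⟩ := exists_nat_gt (gap 0)
  obtain ⟨P, hP⟩ := hall N
  have := hgap P
  linarith

/-- Either the price of `k` relative to `i` can be lowered indefinitely while `z` stays in demand,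
or the exchange of `i` for `k` leads to a bundle demanded together with `z`. -/
theorem exists_low_price_or_exchange (H : IntegralDemand S g) {z : ι → ℤ} (hz : z ∈ S) (i k : ι) :
    (∀ M : ℤ, ∃ P, Supports S g P z ∧ P k - P i < M) ∨
      ∃ P, Supports S g P z ∧ Supports S g P (z - Pi.single i 1 + Pi.single k 1) := by
  rw [or_iff_not_imp_left]
  intro h
  push Not at h
  obtain ⟨M, hM⟩ := h
  -- At the least value of `P k - P i`, a set separating the exchanged bundle would contain `k` but
  -- not `i` and would be tight for `z`. Cutting prices on it would keep `z` in demand, against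
  -- minimality.
  obtain ⟨d, ⟨P, hP, rfl⟩, hmin⟩ := Int.exists_least_of_bdd
    (P := fun d => ∃ P, Supports S g P z ∧ P k - P i = d)
    ⟨M, fun d ⟨P, hP, hd⟩ => hd ▸ hM P hP⟩
    (let ⟨P, hP⟩ := H.exists_supporting_price hz; ⟨_, P, hP, rfl⟩)
  refine ⟨P, hP, ?_⟩
  by_contra hne
  obtain ⟨A, y, hy, hy', hlt⟩ := H.separate P _ (by
    simp [Finset.sum_add_distrib, H.sum_eq_zero z hz]) hne
  have hle : ∑ j ∈ A, z j ≤ ∑ j ∈ A, y j := by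
    have h1 := hy'.2 z hz
    have h2 := hy.value_eq hP
    simp only [sub_dotProduct, ind_dotProduct] at h1
    push_cast at h1
    have : (∑ j ∈ A, (z j : ℝ)) ≤ ∑ j ∈ A, (y j : ℝ) := by linarith
    exact_mod_cast this
  simp only [Pi.add_apply, Pi.sub_apply, Finset.sum_add_distrib, Finset.sum_sub_distrib] at hlt
  have hk : k ∈ A := by by_contra hk; simp [hk] at hlt; split_ifs at hlt <;> omega
  have hi : i ∉ A := by intro hi; simp [hk, hi] at hlt; omega
  have := hmin _ ⟨P - ind A, supports_of_tight hP hy hy' (by simp [hk, hi] at hlt; omega), rfl⟩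
  simp [ind, hk, hi] at this

/-- When both exchanged bundles are demanded, `P k - P i` and `Q k - Q i` are the marginal values of
the two exchanges, and the loss in `hne` orders them. Otherwise one relative price can be pushed
arbitrarily far. -/
theorem exists_separating_prices (H : IntegralDemand S g) {z w : ι → ℤ} (hz : z ∈ S) (hw : w ∈ S)
    {i k : ι}
    (hne : z - Pi.single i 1 + Pi.single k 1 ∈ S → w + Pi.single i 1 - Pi.single k 1 ∈ S →
      g (z - Pi.single i 1 + Pi.single k 1) + g (w + Pi.single i 1 - Pi.single k 1) < g z + g w) :
    ∃ P Q, Supports S g P z ∧ Supports S g Q w ∧ P i = 0 ∧ Q i = 0 ∧ P k < Q k := by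
  suffices h : ∃ P Q, Supports S g P z ∧ Supports S g Q w ∧ P k - P i < Q k - Q i by
    obtain ⟨P, Q, hP, hQ, hlt⟩ := h
    refine ⟨P + fun _ => -P i, Q + fun _ => -Q i, hP.add_const H.sum_eq_zero _,
      hQ.add_const H.sum_eq_zero _, by simp, by simp, ?_⟩
    simp only [Pi.add_apply]; omega
  obtain ⟨Q₀, hQ₀⟩ := H.exists_supporting_price hw
  obtain ⟨P₀, hP₀⟩ := H.exists_supporting_price hz
  rcases H.exists_low_price_or_exchange hz i k with h | ⟨P, hP, hP'⟩
  · obtain ⟨P, hP, hlt⟩ := h (Q₀ k - Q₀ i)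
    exact ⟨P, Q₀, hP, hQ₀, hlt⟩
  rcases H.exists_low_price_or_exchange hw k i with h | ⟨Q, hQ, hQ'⟩
  · obtain ⟨Q, hQ, hlt⟩ := h (P₀ i - P₀ k)
    exact ⟨P₀, Q, hP₀, hQ, by omega⟩
  refine ⟨P, Q, hP, hQ, ?_⟩
  have e : w - Pi.single k 1 + Pi.single i 1 = w + Pi.single i 1 - Pi.single k 1 := by abel
  rw [e] at hQ'
  have h := hne hP'.1 hQ'.1
  have h1 := hP'.value_eq hP
  have h2 := hQ'.value_eq hQ
  simp only [dotProduct_add, dotProduct_sub, dotProduct_single, mul_one] at h1 h2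
  push_cast at h1 h2
  have : (P k : ℝ) - P i < Q k - Q i := by linarith
  exact_mod_cast this

/-- The exchange property of M-concave functions. -/
theorem exchange (H : IntegralDemand S g) {z w : ι → ℤ} (hz : z ∈ S) (hw : w ∈ S) {i : ι}
    (hi : w i < z i) :
    ∃ k, z k < w k ∧ z - Pi.single i 1 + Pi.single k 1 ∈ S ∧
      w + Pi.single i 1 - Pi.single k 1 ∈ S ∧
      g z + g w ≤ g (z - Pi.single i 1 + Pi.single k 1) + g (w + Pi.single i 1 - Pi.single k 1) := by
  by_contra! hne
  have key : ∀ K : Finset ι, (∀ k ∈ K, z k < w k) →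
      ∃ P Q, Supports S g P z ∧ Supports S g Q w ∧ P i = 0 ∧ Q i = 0 ∧ ∀ k ∈ K, P k < Q k := by
    intro K
    induction K using Finset.induction_on with
    | empty =>
      intro _
      obtain ⟨P, hP⟩ := H.exists_supporting_price hz
      obtain ⟨Q, hQ⟩ := H.exists_supporting_price hw
      exact ⟨P + fun _ => -P i, Q + fun _ => -Q i, hP.add_const H.sum_eq_zero _,
        hQ.add_const H.sum_eq_zero _, by simp, by simp, by simp⟩
    | insert k K _ ih =>
      intro hK
      obtain ⟨P, Q, hP, hQ, hPi, hQi, hlt⟩ := ih fun k hk => hK k (Finset.mem_insert_of_mem hk)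
      have hk := hK k (Finset.mem_insert_self k K)
      obtain ⟨P', Q', hP', hQ', hPi', hQi', hlt'⟩ := H.exists_separating_prices hz hw (hne k hk)
      refine ⟨P ⊓ P', Q ⊔ Q', (H.supports_inf_sup hP hP').1, (H.supports_inf_sup hQ hQ').2,
        by simp [hPi, hPi'], by simp [hQi, hQi'], ?_⟩
      intro j hj
      rcases Finset.mem_insert.1 hj with rfl | hj
      · exact (inf_le_right.trans_lt hlt').trans_le le_sup_right
      · exact (inf_le_left.trans_lt (hlt j hj)).trans_le le_sup_left
  obtain ⟨P, Q, hP, hQ, hPi, hQi, hlt⟩ := key {k | z k < w k} (by simp)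
  -- By integrality `P ≤ Q - 1` still holds where `z < w`, but now `P i > Q' i`. So `(P - Q')⁺`
  -- vanishes where `z < w` and is positive at `i`, where `w i < z i`. Its product with `w - z` is
  -- negative, whereas submodularity makes it non-negative.
  have hQ' := hQ.add_const H.sum_eq_zero (-1)
  set Q' := Q + fun _ => (-1 : ℤ) with hQ'def
  have h := H.submodular hP hQ' hz hw
  have h' : (P ⊔ Q') ⬝ᵥ w - Q' ⬝ᵥ w ≥ P ⬝ᵥ z - (P ⊓ Q') ⬝ᵥ z := by
    have : (((P ⊔ Q') ⬝ᵥ w : ℤ) : ℝ) - ((Q' ⬝ᵥ w : ℤ) : ℝ) ≥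
        ((P ⬝ᵥ z : ℤ) : ℝ) - (((P ⊓ Q') ⬝ᵥ z : ℤ) : ℝ) := by linarith
    exact_mod_cast this
  have hlt2 : (P ⊔ Q') ⬝ᵥ w - Q' ⬝ᵥ w < P ⬝ᵥ z - (P ⊓ Q') ⬝ᵥ z := by
    simp only [dotProduct, ← Finset.sum_sub_distrib]
    refine Finset.sum_lt_sum (fun j _ => ?_) ⟨i, Finset.mem_univ i, ?_⟩
    · by_cases hj : z j < w j
      · have := hlt j (by simpa using hj)
        have hle : P j ≤ Q' j := by simp [hQ'def]; omega
        simp [hle]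
      · simp only [Pi.sup_apply, Pi.inf_apply, ← sub_mul]
        rcases le_total (P j) (Q' j) with h | h
        · simp [h]
        · simp only [h, sup_of_le_left, inf_of_le_right]
          exact mul_le_mul_of_nonneg_left (by omega) (by omega)
    · have hPQ : Q' i = -1 := by simp [hQ'def, hQi]
      simp [hPi, hPQ]; omega
  omega

end IntegralDemand

end Exchange

/-! ### Level sets, the lift to `n + 1` goods, and perturbed integral prices. -/

section

/-- Layer-cake decomposition: subtracting the least positive value of `c` from its positive entries
peels off one superlevel set. -/
theorem sum_mul_nonpos_of_superlevel {ι : Type*} [Fintype ι] (d : ι → ℝ) (c : ι → ℝ)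
    (hc : ∀ i, 0 ≤ c i) (h : ∀ r, 0 ≤ r → ∑ i with r < c i, d i ≤ 0) : ∑ i, c i * d i ≤ 0 := by
  classical
  induction hN : (Finset.univ.filter fun i => 0 < c i).card using Nat.strong_induction_on
    generalizing c with
  | _ N ih =>
    subst hN
    rcases (Finset.univ.filter fun i => 0 < c i).eq_empty_or_nonempty with he | hne
    · have h0 : ∀ i, c i = 0 := fun i => le_antisymm (by
        by_contra hi
        have : i ∈ Finset.univ.filter fun i => 0 < c i := by simpa using hi
        simp [he] at this) (hc i)
      simp [h0]
    obtain ⟨a, ha, hmin⟩ := Finset.exists_min_image _ c hne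
    have ha' : 0 < c a := by simpa using ha
    let c' : ι → ℝ := fun i => if 0 < c i then c i - c a else 0
    have hc' : ∀ i, 0 ≤ c' i := by
      intro i
      simp only [c']
      split_ifs with hi
      · have := hmin i (by simpa using hi)
        linarith
      · exact le_rfl
    have hlt : ∀ r, 0 ≤ r → ∀ i, r < c' i ↔ r + c a < c i := by
      intro r hr i
      simp only [c']
      split_ifs with hi
      · exact lt_sub_iff_add_lt
      · constructor <;> intro <;> linarith
    have e : ∑ i, c i * d i = ∑ i, c' i * d i + c a * ∑ i with 0 < c i, d i := by
      rw [Finset.mul_sum, Finset.sum_filter, ← Finset.sum_add_distrib]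
      refine Finset.sum_congr rfl fun i _ => ?_
      simp only [c']
      split_ifs with hi
      · ring
      · have : c i = 0 := le_antisymm (not_lt.1 hi) (hc i)
        simp [this]
    rw [e]
    refine add_nonpos (ih _ ?_ c' hc' (fun r hr => ?_) rfl)
      (mul_nonpos_of_nonneg_of_nonpos ha'.le (h 0 le_rfl))
    · refine Finset.card_lt_card ⟨fun i => ?_, fun hsub => ?_⟩
      · simp only [Finset.mem_filter, Finset.mem_univ, true_and, hlt 0 le_rfl i]
        intro hi; linarith
      · have := hsub (by simpa using ha' : a ∈ _)
        simp only [Finset.mem_filter, Finset.mem_univ, true_and, hlt 0 le_rfl a] at this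
        linarith
    · simp only [hlt r hr]
      exact h _ (by linarith)

theorem exists_superlevel_sum_pos {ι : Type*} [Fintype ι] (d c : ι → ℝ) (hd : ∑ i, d i = 0)
    (h : 0 < ∑ i, c i * d i) : ∃ r, 0 < ∑ i with r < c i, d i := by
  by_contra! hne
  obtain ⟨m, hm⟩ := (Set.finite_range c).bddBelow
  have := sum_mul_nonpos_of_superlevel d (fun i => c i - m)
    (fun i => sub_nonneg.2 (hm ⟨i, rfl⟩)) (fun r _ => by
      simpa only [lt_sub_iff_add_lt] using hne (r + m))
  simp only [sub_mul, Finset.sum_sub_distrib, ← Finset.mul_sum, hd] at this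
  linarith

namespace Valuation

variable {n : ℕ} (v : Valuation n)

/-- The effective domain. -/
def dom : Set (Fin n → ℤ) := {x | v.val x ≠ ⊥}

/-- The value as a real number (`0` outside the domain). -/
def real (x : Fin n → ℤ) : ℝ := (v.val x).unbotD 0

theorem val_eq_coe {x : Fin n → ℤ} (hx : x ∈ v.dom) : v.val x = (v.real x : WithBot ℝ) := by
  obtain ⟨a, ha⟩ := WithBot.ne_bot_iff_exists.1 hx
  simp [real, ← ha]

theorem utility_eq_coe (p : Fin n → ℝ) {x : Fin n → ℤ} (hx : x ∈ v.dom) :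
    v.utility p x = ((v.real x - ∑ i, p i * (x i : ℝ) : ℝ) : WithBot ℝ) := by
  rw [utility, utilityOfValue, v.val_eq_coe hx, ← WithBot.coe_add, sub_eq_add_neg]

theorem utility_eq_bot (p : Fin n → ℝ) {x : Fin n → ℤ} (hx : x ∉ v.dom) :
    v.utility p x = ⊥ := by
  have : v.val x = ⊥ := not_not.1 hx
  rw [utility, utilityOfValue, this, WithBot.bot_add]

theorem mem_demand_iff {p : Fin n → ℝ} {x : Fin n → ℤ} :
    x ∈ v.demand p ↔ x ∈ v.dom ∧ ∀ y ∈ v.dom,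
      v.real y - ∑ i, p i * (y i : ℝ) ≤ v.real x - ∑ i, p i * (x i : ℝ) := by
  constructor
  · rintro ⟨hx, h⟩
    refine ⟨hx, fun y hy => ?_⟩
    have := h y
    rwa [v.utility_eq_coe p hy, v.utility_eq_coe p hx, WithBot.coe_le_coe] at this
  · rintro ⟨hx, h⟩
    refine ⟨hx, fun y => ?_⟩
    by_cases hy : y ∈ v.dom
    · rw [v.utility_eq_coe p hy, v.utility_eq_coe p hx, WithBot.coe_le_coe]
      exact h y hy
    · rw [v.utility_eq_bot p hy]
      exact bot_le

theorem isClosed_setOf_mem_demand (x : Fin n → ℤ) : IsClosed {p | x ∈ v.demand p} := by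
  by_cases hx : x ∈ v.dom
  · simp only [mem_demand_iff, hx, true_and, Set.ofPred_forall]
    refine isClosed_iInter fun y => isClosed_iInter fun _ => isClosed_le ?_ ?_ <;> fun_prop
  · have : {p | x ∈ v.demand p} = ∅ := by
      ext p; simp [mem_demand_iff, hx]
    rw [this]; exact isClosed_empty

/-- The domain of `mLift v.val`. -/
def liftDom : Set (Fin (n + 1) → ℤ) := {z | z 0 = -∑ i, Fin.tail z i ∧ Fin.tail z ∈ v.dom}

/-- The real values of `mLift v.val` on its domain. -/
def liftReal (z : Fin (n + 1) → ℤ) : ℝ := v.real (Fin.tail z)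

end Valuation

/-- Prices of the goods `1, …, n` relative to the price of good `0`. -/
def relPrice {n : ℕ} (q : Fin (n + 1) → ℝ) : Fin n → ℝ := fun i => q i.succ - q 0

theorem continuous_relPrice {n : ℕ} : Continuous (relPrice (n := n)) := by
  unfold relPrice; fun_prop

variable {n : ℕ}

theorem sum_relPrice_mul (q : Fin (n + 1) → ℝ) {z : Fin (n + 1) → ℤ}
    (hz : z 0 = -∑ i, Fin.tail z i) :
    ∑ i, relPrice q i * (Fin.tail z i : ℝ) = ∑ i, q i * (z i : ℝ) := by
  rw [Fin.sum_univ_succ, hz]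
  simp only [relPrice, sub_mul, Finset.sum_sub_distrib, ← Finset.mul_sum, Fin.tail]
  push_cast
  ring

theorem supports_lift_iff (v : Valuation n) {P z : Fin (n + 1) → ℤ}
    (hz : z 0 = -∑ i, Fin.tail z i) :
    Supports v.liftDom v.liftReal P z ↔ Fin.tail z ∈ v.demand (relPrice fun i => (P i : ℝ)) := by
  have key : ∀ z : Fin (n + 1) → ℤ, z 0 = -∑ i, Fin.tail z i →
      ((P ⬝ᵥ z : ℤ) : ℝ) = ∑ i, relPrice (fun i => (P i : ℝ)) i * (Fin.tail z i : ℝ) := by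
    intro z hz
    rw [sum_relPrice_mul _ hz]
    simp [dotProduct]
  rw [Supports, v.mem_demand_iff, key z hz]
  constructor
  · rintro ⟨h1, h2⟩
    refine ⟨h1.2, fun y hy => ?_⟩
    have h0 : (Fin.cons (-∑ i, y i) y : Fin (n + 1) → ℤ) 0 =
      -∑ i, Fin.tail (Fin.cons (-∑ i, y i) y : Fin (n + 1) → ℤ) i := by simp
    have := h2 (Fin.cons (-∑ i, y i) y) ⟨h0, by simpa using hy⟩
    rw [key _ h0] at this
    simpa [Valuation.liftReal] using this
  · rintro ⟨h1, h2⟩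
    refine ⟨⟨hz, h1⟩, fun y hy => ?_⟩
    rw [key y hy.1]
    exact h2 _ hy.2

theorem surplus_relPrice (b : Fin n → ℤ) (q : Fin (n + 1) → ℝ) (j : Fin (n + 1)) :
    surplus b (relPrice q) j = (((Fin.cons 0 b : Fin (n + 1) → ℤ) j : ℤ) : ℝ) - q j + q 0 := by
  refine Fin.cases ?_ (fun i => ?_) j
  · simp [surplus]
  · simp [surplus, relPrice]; ring

/-- Surpluses at integral prices differ by integers, so perturbations in `[0, 1)` only break ties,
in favour of the smallest. -/
theorem bidDemands_relPrice_iff (b : Fin n → ℤ) (P : Fin (n + 1) → ℤ) {θ : Fin (n + 1) → ℝ}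
    (h0 : ∀ i, 0 ≤ θ i) (h1 : ∀ i, θ i < 1) (k : Fin (n + 1)) :
    BidDemands b (relPrice fun i => P i + θ i) k ↔
      ∀ j, (Fin.cons 0 b : Fin (n + 1) → ℤ) j - P j < (Fin.cons 0 b : Fin (n + 1) → ℤ) k - P k ∨
        ((Fin.cons 0 b : Fin (n + 1) → ℤ) j - P j = (Fin.cons 0 b : Fin (n + 1) → ℤ) k - P k ∧
          θ k ≤ θ j) := by
  refine forall_congr' fun j => ?_
  rw [surplus_relPrice, surplus_relPrice]
  generalize (Fin.cons 0 b : Fin (n + 1) → ℤ) = a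
  have hj0 := h0 j
  have hj1 := h1 j
  have hk0 := h0 k
  have hk1 := h1 k
  rcases lt_trichotomy (a j - P j) (a k - P k) with h | h | h
  · have h' : ((a j : ℝ) - P j) + 1 ≤ a k - P k := by exact_mod_cast h
    simp only [h, true_or, iff_true]
    linarith
  · have h' : ((a j : ℝ) - P j) = a k - P k := by exact_mod_cast h
    simp only [h, lt_irrefl, true_and, false_or]
    constructor <;> intro <;> linarith
  · have h' : ((a k : ℝ) - P k) + 1 ≤ a j - P j := by exact_mod_cast h
    simp only [h.not_gt, h.ne', false_and, or_self, iff_false, not_le]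
    linarith

theorem not_marginal_relPrice (B : BidList n) (P : Fin (n + 1) → ℤ) {θ : Fin (n + 1) → ℝ}
    (h0 : ∀ i, 0 ≤ θ i) (h1 : ∀ i, θ i < 1) (hθ : Function.Injective θ) :
    ¬ B.Marginal (relPrice fun i => P i + θ i) := by
  rintro ⟨b, _, i, j, hij, hi, hj⟩
  rw [bidDemands_relPrice_iff b P h0 h1] at hi hj
  have e1 := hi j
  have e2 := hj i
  apply hij
  apply hθ
  rcases e1 with e1 | e1 <;> rcases e2 with e2 | e2
  · omega
  · omega
  · omega
  · exact le_antisymm e1.2 e2.2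

theorem bundle_relPrice_congr (B : BidList n) (P : Fin (n + 1) → ℤ) {θ θ' : Fin (n + 1) → ℝ}
    (h0 : ∀ i, 0 ≤ θ i) (h1 : ∀ i, θ i < 1) (h0' : ∀ i, 0 ≤ θ' i) (h1' : ∀ i, θ' i < 1)
    (hθ : ∀ i j, θ i ≤ θ j ↔ θ' i ≤ θ' j) :
    B.bundle (relPrice fun i => P i + θ i) = B.bundle (relPrice fun i => P i + θ' i) := by
  ext k
  unfold BidList.bundle
  simp only [bidDemands_relPrice_iff _ P h0 h1, bidDemands_relPrice_iff _ P h0' h1', hθ]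

/-- Ranks in decreasing order of `c`, scaled into `(0, 1)`. Sorting breaks the ties of `c`, which
keeps `θ` injective and the perturbed price non-marginal. -/
theorem exists_injective_antitone {m : ℕ} (c : Fin m → ℝ) :
    ∃ θ : Fin m → ℝ, Function.Injective θ ∧ (∀ i, 0 < θ i) ∧ (∀ i, θ i < 1) ∧
      ∀ i j, c j < c i → θ i < θ j := by
  let σ := Tuple.sort fun i => -c i
  have hσ : Monotone ((fun i => -c i) ∘ σ) := Tuple.monotone_sort _
  have hm : (0 : ℝ) < m + 1 := by positivity
  refine ⟨fun i => ((σ.symm i : ℕ) + 1 : ℝ) / (m + 1), fun i j hij => ?_, fun i => by positivity,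
    fun i => ?_, fun i j hij => ?_⟩
  · have : ((σ.symm i : ℕ) : ℝ) = (σ.symm j : ℕ) := by
      have := (div_left_inj' hm.ne').1 hij
      linarith
    exact σ.symm.injective (Fin.ext (by exact_mod_cast this))
  · rw [div_lt_one hm]
    have : ((σ.symm i : ℕ) : ℝ) < m := by exact_mod_cast (σ.symm i).2
    linarith
  · have : σ.symm i < σ.symm j := by
      by_contra! hle
      have := hσ hle
      simp at this
      linarith
    have : ((σ.symm i : ℕ) : ℝ) < (σ.symm j : ℕ) := by exact_mod_cast this
    exact div_lt_div_of_pos_right (by linarith) hm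

end

/-! ### Chambers of prices and the integral demand of a represented valuation. -/

section

variable {n : ℕ} {v : Valuation n} {B : BidList n}

namespace BidList.Represents

open Filter Topology

theorem demand_eq_bundle (hB : B.Represents v) {p : Fin n → ℝ} (hp : ¬ B.Marginal p) :
    v.demand p = {B.bundle p} := by
  rw [hB p, BidList.demand, if_neg hp]

theorem bundle_mem (hB : B.Represents v) {p : Fin n → ℝ} (hp : ¬ B.Marginal p) :
    B.bundle p ∈ v.demand p := by
  rw [hB.demand_eq_bundle hp]; rfl

theorem nearbyBundles_subset_demand (hB : B.Represents v) (p : Fin n → ℝ) :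
    B.nearbyBundles p ⊆ v.demand p := by
  intro x hx
  refine (v.isClosed_setOf_mem_demand x).closure_subset (Metric.mem_closure_iff.2 fun ε hε => ?_)
  obtain ⟨q, hq, hm, rfl⟩ := hx ε hε
  exact ⟨q, hB.bundle_mem hm, by rwa [dist_comm]⟩

theorem discreteHull_subset_demand (hB : B.Represents v) (p : Fin n → ℝ) :
    BidList.discreteHull (B.nearbyBundles p) ⊆ v.demand p := by
  by_cases hp : B.Marginal p
  · rw [hB p, BidList.demand, if_pos hp]
  · intro x hx
    have hsub := hB.nearbyBundles_subset_demand p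
    rw [hB.demand_eq_bundle hp] at hsub ⊢
    have hx' := convexHull_mono (Set.image_mono hsub) hx
    rw [Set.image_singleton, convexHull_singleton, Set.mem_singleton_iff] at hx'
    rw [Set.mem_singleton_iff]
    ext i
    exact_mod_cast congrFun hx' i

/-- At an integral price some nearby bundle is demanded at all prices that are obtained by lowering
by one the prices of the goods on which a given functional is large. -/
theorem exists_chamber_bundle (hB : B.Represents v) (P : Fin (n + 1) → ℤ) (c : Fin (n + 1) → ℝ) :
    ∃ y ∈ B.nearbyBundles (relPrice fun i => (P i : ℝ)), ∀ A : Finset (Fin (n + 1)),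
      (∀ i ∈ A, ∀ j ∉ A, c j < c i) → y ∈ v.demand (relPrice fun i => ((P - ind A) i : ℝ)) := by
  obtain ⟨θ, hinj, hpos, hlt, hanti⟩ := exists_injective_antitone c
  have hone : (1 : ℝ) ∈ Set.Ioc (0 : ℝ) 1 := by simp
  -- The bundle of the chamber of `θ`. Shrinking `θ` to `t * θ` keeps the order, so this bundle is
  -- demanded arbitrarily close to `P`.
  refine ⟨B.bundle (relPrice fun i => P i + θ i), ?_, fun A hA => ?_⟩
  · intro ε hε
    have hcont : Continuous fun t : ℝ => relPrice fun i : Fin (n + 1) => (P i : ℝ) + t * θ i :=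
      continuous_relPrice.comp (by fun_prop)
    have hlim : Tendsto (fun t : ℝ => relPrice fun i : Fin (n + 1) => (P i : ℝ) + t * θ i)
        (𝓝[>] 0) (𝓝 (relPrice fun i => (P i : ℝ))) := by
      have := (hcont.tendsto 0).mono_left (nhdsWithin_le_nhds (s := Set.Ioi 0))
      simpa using this
    obtain ⟨t, hd, ht⟩ := ((hlim.eventually (Metric.ball_mem_nhds _ hε)).and
      (Ioc_mem_nhdsGT zero_lt_one)).exists
    have h0 : ∀ i, 0 ≤ t * θ i := fun i => mul_nonneg ht.1.le (hpos i).le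
    have h1 : ∀ i, t * θ i < 1 := fun i =>
      (mul_le_of_le_one_left (hpos i).le ht.2).trans_lt (hlt i)
    refine ⟨_, hd, not_marginal_relPrice B P h0 h1 fun i j hij =>
      hinj (mul_left_cancel₀ ht.1.ne' hij), ?_⟩
    exact bundle_relPrice_congr B P h0 h1 (fun i => (hpos i).le) hlt fun i j =>
      mul_le_mul_iff_right₀ ht.1
  -- Up to a common shift, `P - ind A` is `P + χ`. Since `θ` is smaller on `A` than off it, `(1 - t)
  -- * χ + t * θ` is ordered like `θ`; it tends to `χ` as `t → 0`, and demand is closed.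
  · let χ : Fin (n + 1) → ℝ := fun i => if i ∈ A then 0 else 1
    have hrel : (relPrice fun i => ((P - ind A) i : ℝ)) =
        relPrice fun i => (P i : ℝ) + χ i := by
      have : ∀ i, (((P - ind A) i : ℤ) : ℝ) = P i + χ i - 1 := by
        intro i
        simp only [Pi.sub_apply, ind, χ]
        split_ifs <;> push_cast <;> ring
      ext i
      simp only [relPrice, this]
      ring
    have hcont : Continuous fun t : ℝ =>
        relPrice fun i : Fin (n + 1) => (P i : ℝ) + ((1 - t) * χ i + t * θ i) :=
      continuous_relPrice.comp (by fun_prop)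
    have hlim : Tendsto
        (fun t : ℝ => relPrice fun i : Fin (n + 1) => (P i : ℝ) + ((1 - t) * χ i + t * θ i))
        (𝓝[>] 0) (𝓝 (relPrice fun i => (P i : ℝ) + χ i)) := by
      have := (hcont.tendsto 0).mono_left (nhdsWithin_le_nhds (s := Set.Ioi 0))
      simpa using this
    rw [hrel]
    refine (v.isClosed_setOf_mem_demand _).mem_of_tendsto hlim ?_
    filter_upwards [Ioc_mem_nhdsGT zero_lt_one] with t ht
    have hχ : ∀ i, 0 ≤ χ i ∧ χ i ≤ 1 := by
      intro i; simp only [χ]; split_ifs <;> simp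
    have h0 : ∀ i, 0 ≤ (1 - t) * χ i + t * θ i := fun i =>
      add_nonneg (mul_nonneg (by linarith [ht.2]) (hχ i).1) (mul_nonneg ht.1.le (hpos i).le)
    have h1 : ∀ i, (1 - t) * χ i + t * θ i < 1 := by
      intro i
      have e1 : (1 - t) * χ i ≤ 1 - t := mul_le_of_le_one_right (by linarith [ht.2]) (hχ i).2
      have e2 : t * θ i < t := mul_lt_of_lt_one_right ht.1 (hlt i)
      linarith
    have hmono : ∀ i j, θ i < θ j → (1 - t) * χ i + t * θ i < (1 - t) * χ j + t * θ j := by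
      intro i j hij
      have e2 : t * θ i < t * θ j := mul_lt_mul_of_pos_left hij ht.1
      have e1 : χ i ≤ χ j := by
        by_cases hi : i ∈ A
        · simp [χ, hi]; split_ifs <;> simp
        · by_cases hj : j ∈ A
          · exact absurd hij (hanti _ _ (hA j hj i hi)).not_gt
          · simp [χ, hi, hj]
      have e3 := mul_le_mul_of_nonneg_left e1 (by linarith [ht.2] : 0 ≤ 1 - t)
      linarith
    have hle : ∀ i j, (1 - t) * χ i + t * θ i ≤ (1 - t) * χ j + t * θ j ↔ θ i ≤ θ j := by
      intro i j
      constructor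
      · intro h
        by_contra! hlt'
        exact absurd h (hmono _ _ hlt').not_ge
      · intro h
        rcases h.eq_or_lt with h | h
        · rw [hinj h]
        · exact (hmono _ _ h).le
    have hb := bundle_relPrice_congr B P h0 h1 (fun i => (hpos i).le) hlt hle
    rw [← hb]
    refine hB.bundle_mem (not_marginal_relPrice B P h0 h1 fun i j hij => hinj ?_)
    exact le_antisymm ((hle i j).1 hij.le) ((hle j i).1 hij.ge)

theorem liftDom_cons {y : Fin n → ℤ} :
    (Fin.cons (-∑ i, y i) y : Fin (n + 1) → ℤ) 0 =
      -∑ i, Fin.tail (Fin.cons (-∑ i, y i) y : Fin (n + 1) → ℤ) i := by simp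

theorem supports_cons {P : Fin (n + 1) → ℤ} {y : Fin n → ℤ}
    (h : y ∈ v.demand (relPrice fun i => (P i : ℝ))) :
    Supports v.liftDom v.liftReal P (Fin.cons (-∑ i, y i) y) := by
  rw [supports_lift_iff v liftDom_cons]
  simpa using h

theorem sum_cons_neg_sum (y : Fin n → ℤ) :
    ∑ i, (Fin.cons (-∑ i, y i) y : Fin (n + 1) → ℤ) i = 0 := by
  simp [Fin.sum_univ_succ]

theorem integralDemand (hB : B.Represents v) : IntegralDemand v.liftDom v.liftReal where
  sum_eq_zero := by
    intro z hz
    rw [Fin.sum_univ_succ, hz.1]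
    simp [Fin.tail]
  exists_supports := by
    intro P
    obtain ⟨y, -, hy⟩ := hB.exists_chamber_bundle P 0
    refine ⟨_, supports_cons (y := y) ?_⟩
    have := hy ∅ (by simp)
    simpa [ind] using this
  square := by
    intro P a b hab
    -- The chamber is based at the upper corner; cutting the prices of `a` and `b`, a superlevel set
    -- of their indicator, leads to `P`.
    obtain ⟨y, -, hy⟩ := hB.exists_chamber_bundle (P + Pi.single a 1 + Pi.single b 1)
      (fun i => if i ∈ ({a, b} : Finset _) then 1 else 0)
    refine ⟨_, supports_cons (y := y) ?_, supports_cons (y := y) ?_⟩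
    · have e : P + Pi.single a 1 + Pi.single b 1 - ind {a, b} = P := by
        ext i
        by_cases hia : i = a
        · subst hia; simp [ind, hab]
        · by_cases hib : i = b
          · subst hib; simp [ind, hia]
          · simp [ind, hia, hib]
      have := hy {a, b} (by intro i hi j hj; simp only [hi, hj, if_true, if_false]; norm_num)
      rwa [e] at this
    · have := hy ∅ (by simp)
      simpa [ind] using this
  separate := by
    intro P t ht hns
    have ht0 : t 0 = -∑ i, Fin.tail t i := by
      rw [Fin.sum_univ_succ] at ht
      simp only [Fin.tail]; omega
    rw [supports_lift_iff v ht0] at hns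
    have hhull := fun h => hns (hB.discreteHull_subset_demand _ h)
    set p := relPrice fun i => (P i : ℝ) with hp
    have hfin : (B.nearbyBundles p).Finite :=
      v.finite_dom.subset fun x hx => (hB.nearbyBundles_subset_demand p hx).1
    -- A functional `f` separates `t` from the hull of the nearby bundles. The bundle `y` of the
    -- chamber of `c` is one of them, so `c` is larger on `t` than on `y`, and some superlevel set
    -- of `c` already witnesses this.
    obtain ⟨f, u, hf, hu⟩ := geometric_hahn_banach_closed_point (convex_convexHull ℝ _)
      ((hfin.image fun (y : Fin n → ℤ) (i : Fin n) => (y i : ℝ)).isClosed_convexHull (𝕜 := ℝ)) hhull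
    let c : Fin (n + 1) → ℝ := Fin.cons 0 fun i => f (Pi.single i 1)
    have hfc : ∀ x : Fin n → ℝ, f x = ∑ i, c (Fin.succ i) * x i := by
      intro x
      conv_lhs => rw [pi_eq_sum_univ' x]
      simp [c, mul_comm]
    obtain ⟨y, hy, hyA⟩ := hB.exists_chamber_bundle P c
    have hlt := (hf _ (subset_convexHull ℝ _ ⟨y, hy, rfl⟩)).trans hu
    rw [hfc, hfc] at hlt
    obtain ⟨r, hr⟩ := exists_superlevel_sum_pos
      (fun i => (t i : ℝ) - ((Fin.cons (-∑ i, y i) y : Fin (n + 1) → ℤ) i : ℤ)) c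
      (by
        rw [Finset.sum_sub_distrib]
        have h1 : ∑ i, (t i : ℝ) = 0 := by exact_mod_cast ht
        have h2 : ∑ i, ((Fin.cons (-∑ i, y i) y : Fin (n + 1) → ℤ) i : ℝ) = 0 := by
          exact_mod_cast sum_cons_neg_sum y
        rw [h1, h2, sub_zero])
      (by
        rw [Fin.sum_univ_succ]
        simp only [mul_sub, Finset.sum_sub_distrib, Fin.cons_succ]
        simp only [Fin.tail] at hlt
        simp only [c, Fin.cons_zero, zero_mul, sub_zero, zero_add] at hlt ⊢
        linarith)
    refine ⟨Finset.univ.filter fun i => r < c i, _, supports_cons (y := y) ?_, supports_cons (y := y) ?_, ?_⟩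
    · have := hyA ∅ (by simp)
      simpa [ind] using this
    · refine hyA _ ?_
      intro i hi j hj
      simp only [Finset.mem_filter, Finset.mem_univ, true_and, not_lt] at hi hj
      exact hj.trans_lt hi
    · rw [Finset.sum_sub_distrib, sub_pos] at hr
      exact_mod_cast hr

end BidList.Represents

end

/-! ### M♮-concavity and the shape of the domain. -/

section

/-- The exchange properties of M♮-concave functions, for a function given by its domain and its
real values. -/
structure MNatConcave {n : ℕ} (S : Set (Fin n → ℤ)) (g : (Fin n → ℤ) → ℝ) : Prop where
  exchange : ∀ x ∈ S, ∀ y ∈ S, ∀ i, y i < x i →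
    (x - Pi.single i 1 ∈ S ∧ y + Pi.single i 1 ∈ S ∧
      g x + g y ≤ g (x - Pi.single i 1) + g (y + Pi.single i 1)) ∨
    ∃ k, x k < y k ∧ x - Pi.single i 1 + Pi.single k 1 ∈ S ∧ y + Pi.single i 1 - Pi.single k 1 ∈ S ∧
      g x + g y ≤ g (x - Pi.single i 1 + Pi.single k 1) + g (y + Pi.single i 1 - Pi.single k 1)
  augment : ∀ x ∈ S, ∀ y ∈ S, ∑ i, x i < ∑ i, y i →
    ∃ k, x k < y k ∧ x + Pi.single k 1 ∈ S ∧ y - Pi.single k 1 ∈ S ∧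
      g x + g y ≤ g (x + Pi.single k 1) + g (y - Pi.single k 1)

variable {n : ℕ} {v : Valuation n} {B : BidList n}

/-- The utility `v(x) - p · x` as a real number. -/
def Valuation.net (v : Valuation n) (p : Fin n → ℝ) (x : Fin n → ℤ) : ℝ :=
  v.real x - ∑ i, p i * (x i : ℝ)

theorem sum_mul_single (p : Fin n → ℝ) (k : Fin n) :
    ∑ i, p i * ((Pi.single k 1 : Fin n → ℤ) i : ℝ) = p k := by
  rw [Finset.sum_eq_single k]
  · simp
  · intro j _ hj; simp [hj]
  · simp

theorem MNatConcave.sub_linear {S : Set (Fin n → ℤ)} {g : (Fin n → ℤ) → ℝ} (H : MNatConcave S g)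
    (p : Fin n → ℝ) : MNatConcave S fun x => g x - ∑ i, p i * (x i : ℝ) := by
  have hadd : ∀ (x : Fin n → ℤ) k, ∑ i, p i * (((x + Pi.single k 1 : Fin n → ℤ) i : ℤ) : ℝ) =
      ∑ i, p i * (x i : ℝ) + p k := by
    intro x k
    simp only [Pi.add_apply]
    push_cast
    simp only [mul_add, Finset.sum_add_distrib, sum_mul_single]
  have hsub : ∀ (x : Fin n → ℤ) k, ∑ i, p i * (((x - Pi.single k 1 : Fin n → ℤ) i : ℤ) : ℝ) =
      ∑ i, p i * (x i : ℝ) - p k := by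
    intro x k
    simp only [Pi.sub_apply]
    push_cast
    simp only [mul_sub, Finset.sum_sub_distrib, sum_mul_single]
  refine ⟨fun x hx y hy i hi => ?_, fun x hx y hy hlt => ?_⟩
  · rcases H.exchange x hx y hy i hi with ⟨h1, h2, h3⟩ | ⟨k, hk, h1, h2, h3⟩
    · refine Or.inl ⟨h1, h2, ?_⟩
      rw [hadd, hsub]; linarith
    · refine Or.inr ⟨k, hk, h1, h2, ?_⟩
      rw [hadd, hsub, hsub, hadd]; linarith
  · obtain ⟨k, hk, h1, h2, h3⟩ := H.augment x hx y hy hlt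
    refine ⟨k, hk, h1, h2, ?_⟩
    rw [hadd, hsub]; linarith

theorem tail_cons_sub_add_succ (a : ℤ) (x : Fin n → ℤ) (i k : Fin n) :
    Fin.tail ((Fin.cons a x : Fin (n + 1) → ℤ) - Pi.single i.succ 1 + Pi.single k.succ 1) =
      x - Pi.single i 1 + Pi.single k 1 := by
  ext j; simp [Fin.tail, Pi.single_apply]

theorem tail_cons_sub_add_zero (a : ℤ) (x : Fin n → ℤ) (i : Fin n) :
    Fin.tail ((Fin.cons a x : Fin (n + 1) → ℤ) - Pi.single i.succ 1 + Pi.single 0 1) =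
      x - Pi.single i 1 := by
  ext j; simp [Fin.tail, Pi.single_apply]

theorem tail_cons_add_sub_succ (a : ℤ) (x : Fin n → ℤ) (i k : Fin n) :
    Fin.tail ((Fin.cons a x : Fin (n + 1) → ℤ) + Pi.single i.succ 1 - Pi.single k.succ 1) =
      x + Pi.single i 1 - Pi.single k 1 := by
  ext j; simp [Fin.tail, Pi.single_apply]

theorem tail_cons_add_sub_zero (a : ℤ) (x : Fin n → ℤ) (i : Fin n) :
    Fin.tail ((Fin.cons a x : Fin (n + 1) → ℤ) + Pi.single i.succ 1 - Pi.single 0 1) =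
      x + Pi.single i 1 := by
  ext j; simp [Fin.tail, Pi.single_apply]

theorem tail_cons_sub_zero_add (a : ℤ) (x : Fin n → ℤ) (k : Fin n) :
    Fin.tail ((Fin.cons a x : Fin (n + 1) → ℤ) - Pi.single 0 1 + Pi.single k.succ 1) =
      x + Pi.single k 1 := by
  ext j; simp [Fin.tail, Pi.single_apply]

theorem tail_cons_add_zero_sub (a : ℤ) (x : Fin n → ℤ) (k : Fin n) :
    Fin.tail ((Fin.cons a x : Fin (n + 1) → ℤ) + Pi.single 0 1 - Pi.single k.succ 1) =
      x - Pi.single k 1 := by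
  ext j; simp [Fin.tail, Pi.single_apply]

/-- Exchange for the lift, split by whether good `0` takes part. Fewer items mean a larger
coordinate `0`, so `augment` is exchange at `0`. -/
theorem BidList.Represents.mNatConcave (hB : B.Represents v) (p : Fin n → ℝ) :
    MNatConcave v.dom (v.net p) := by
  suffices h : MNatConcave v.dom v.real from h.sub_linear p
  have H := hB.integralDemand
  have hmem : ∀ x ∈ v.dom, (Fin.cons (-∑ i, x i) x : Fin (n + 1) → ℤ) ∈ v.liftDom :=
    fun x hx => ⟨BidList.Represents.liftDom_cons, by simpa using hx⟩
  refine ⟨fun x hx y hy i hi => ?_, fun x hx y hy hlt => ?_⟩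
  · obtain ⟨k, hk, h1, h2, h3⟩ := H.exchange (hmem x hx) (hmem y hy) (i := i.succ) (by simpa using hi)
    replace h1 := h1.2
    replace h2 := h2.2
    simp only [Valuation.liftReal] at h3
    induction k using Fin.cases with
    | zero =>
      rw [tail_cons_sub_add_zero] at h1 h3
      rw [tail_cons_add_sub_zero] at h2 h3
      exact Or.inl ⟨h1, h2, by simpa using h3⟩
    | succ k =>
      rw [tail_cons_sub_add_succ] at h1 h3
      rw [tail_cons_add_sub_succ] at h2 h3
      exact Or.inr ⟨k, by simpa using hk, h1, h2, by simpa using h3⟩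
  · obtain ⟨k, hk, h1, h2, h3⟩ := H.exchange (hmem x hx) (hmem y hy) (i := 0) (by simpa using hlt)
    replace h1 := h1.2
    replace h2 := h2.2
    simp only [Valuation.liftReal] at h3
    induction k using Fin.cases with
    | zero => simp at hk; omega
    | succ k =>
      rw [tail_cons_sub_zero_add] at h1 h3
      rw [tail_cons_add_zero_sub] at h2 h3
      exact ⟨k, by simpa using hk, h1, h2, by simpa using h3⟩

theorem exists_bidDemands (b : Fin n → ℤ) (p : Fin n → ℝ) : ∃ i, BidDemands b p i :=
  Finite.exists_max (surplus b p)

open Classical in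
theorem BidList.sum_bundle {p : Fin n → ℝ} (hp : ¬ B.Marginal p) :
    ∑ k, B.bundle p k = ∑ b ∈ B.support with ¬ BidDemands b p 0, B b := by
  simp only [BidList.bundle, Finset.sum_filter]
  rw [Finset.sum_comm]
  refine Finset.sum_congr rfl fun b hb => ?_
  obtain ⟨i, hi⟩ := exists_bidDemands b p
  have huniq : ∀ j, BidDemands b p j ↔ j = i := by
    intro j
    constructor
    · intro hj
      by_contra hne
      exact hp ⟨b, hb, j, i, hne, hj, hi⟩
    · rintro rfl; exact hi
  simp only [huniq]
  induction i using Fin.cases with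
  | zero => simp [Fin.succ_ne_zero]
  | succ i => simp [(Fin.succ_ne_zero i).symm]

/-- A bound for all coordinates of all bids. -/
theorem BidList.exists_bound (B : BidList n) : ∃ M : ℤ, 0 < M ∧ ∀ b ∈ B.support, ∀ i, |b i| < M := by
  refine ⟨1 + ∑ b ∈ B.support, ∑ i, |b i|, ?_, fun b hb i => ?_⟩
  · have : 0 ≤ ∑ b ∈ B.support, ∑ i, |b i| :=
      Finset.sum_nonneg fun b _ => Finset.sum_nonneg fun i _ => abs_nonneg _
    omega
  · have h1 : |b i| ≤ ∑ i, |b i| :=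
      Finset.single_le_sum (fun i _ => abs_nonneg (b i)) (Finset.mem_univ i)
    have h2 : ∑ i, |b i| ≤ ∑ b ∈ B.support, ∑ i, |b i| :=
      Finset.single_le_sum (f := fun b : Fin n → ℤ => ∑ i, |b i|)
        (fun b _ => Finset.sum_nonneg fun i _ => abs_nonneg _) hb
    omega

namespace BidList.Represents

/-- At prices above all bids every bid is rejected. -/
theorem zero_mem (hB : B.Represents v) : (0 : Fin n → ℤ) ∈ v.dom := by
  obtain ⟨M, hM, hb⟩ := B.exists_bound
  obtain ⟨θ, hinj, hpos, hlt, -⟩ := exists_injective_antitone (fun _ : Fin (n + 1) => 0)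
  let P : Fin (n + 1) → ℤ := Fin.cons 0 fun _ => M
  have hm := not_marginal_relPrice B P (fun i => (hpos i).le) hlt hinj
  have h0 : B.bundle (relPrice fun i => P i + θ i) = 0 := by
    ext k
    classical
    unfold BidList.bundle
    refine Finset.sum_eq_zero fun b hbk => ?_
    rw [Finset.mem_filter, bidDemands_relPrice_iff b P (fun i => (hpos i).le) hlt] at hbk
    have h1 := hbk.2 0
    have h2 := abs_lt.1 (hb b hbk.1 k)
    simp [P] at h1
    omega
  exact h0 ▸ (hB.bundle_mem hm).1

/-- At prices below all bids nothing is rejected, so the size of the demanded bundle is the sum of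
all weights, which cannot be negative. -/
theorem maxWeight_pos (hB : B.Represents v) (hn : 1 ≤ n) (hne : B.support.Nonempty) :
    1 ≤ B.maxWeight := by
  by_contra! hW
  rw [BidList.maxWeight, dif_pos hne, Finset.sup'_lt_iff] at hW
  obtain ⟨M, hM, hb⟩ := B.exists_bound
  obtain ⟨θ, hinj, hpos, hlt, -⟩ := exists_injective_antitone (fun _ : Fin (n + 1) => 0)
  let P : Fin (n + 1) → ℤ := Fin.cons 0 fun _ => -M
  have hm := not_marginal_relPrice B P (fun i => (hpos i).le) hlt hinj
  have h1 : 0 ≤ ∑ k, B.bundle (relPrice fun i => P i + θ i) k :=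
    Finset.sum_nonneg fun k _ => v.nonneg_dom _ (hB.bundle_mem hm).1 k
  have h2 : ∀ b ∈ B.support, ¬ BidDemands b (relPrice fun i => P i + θ i) 0 := by
    intro b hbs hd
    rw [bidDemands_relPrice_iff b P (fun i => (hpos i).le) hlt] at hd
    have h1 := hd (Fin.succ ⟨0, hn⟩)
    have h2 := abs_lt.1 (hb b hbs ⟨0, hn⟩)
    simp only [P, Fin.cons_succ, Fin.cons_zero] at h1
    omega
  classical
  rw [BidList.sum_bundle hm, Finset.filter_true_of_mem h2] at h1
  have h3 : ∑ b ∈ B.support, B b < 0 := by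
    refine Finset.sum_neg (fun b hbs => ?_) hne
    have h4 := hW b hbs
    have h5 := Finsupp.mem_support_iff.1 hbs
    omega
  omega

theorem maxWeight_nonneg (hB : B.Represents v) (hn : 1 ≤ n) : 0 ≤ B.maxWeight := by
  by_cases hne : B.support.Nonempty
  · exact zero_le_one.trans (hB.maxWeight_pos hn hne)
  · simp [BidList.maxWeight, hne]

theorem sum_bundle_le (hB : B.Represents v) (hn : 1 ≤ n) {p : Fin n → ℝ} (hp : ¬ B.Marginal p) :
    ∑ k, B.bundle p k ≤ B.numBids * B.maxWeight := by
  classical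
  rw [BidList.sum_bundle hp]
  have hle : ∀ b ∈ B.support, B b ≤ B.maxWeight := by
    intro b hb
    rw [BidList.maxWeight, dif_pos ⟨b, hb⟩]
    exact Finset.le_sup' B hb
  refine (Finset.sum_le_card_nsmul _ _ _ fun b hb => hle b (Finset.mem_filter.1 hb).1).trans ?_
  rw [nsmul_eq_mul]
  refine mul_le_mul_of_nonneg_right ?_ (hB.maxWeight_nonneg hn)
  exact_mod_cast Finset.card_filter_le _ _

/-- A bundle of the domain is demanded at some integral price, hence is a bundle of a non-marginal
price or a convex combination of such bundles. -/
theorem sum_le (hB : B.Represents v) (hn : 1 ≤ n) {x : Fin n → ℤ} (hx : x ∈ v.dom) :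
    ∑ i, x i ≤ B.numBids * B.maxWeight := by
  obtain ⟨P, hP⟩ := hB.integralDemand.exists_supporting_price
    (z := Fin.cons (-∑ i, x i) x) ⟨liftDom_cons, by simpa using hx⟩
  rw [supports_lift_iff v liftDom_cons, Fin.tail_cons] at hP
  set p := relPrice fun i => (P i : ℝ)
  by_cases hp : B.Marginal p
  · rw [hB p, BidList.demand, if_pos hp] at hP
    have hsub : convexHull ℝ ((fun (y : Fin n → ℤ) (i : Fin n) => (y i : ℝ)) '' B.nearbyBundles p) ⊆
        {f | ∑ i, f i ≤ ((B.numBids * B.maxWeight : ℤ) : ℝ)} := by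
      refine convexHull_min ?_ ?_
      · rintro _ ⟨y, hy, rfl⟩
        obtain ⟨q, -, hq, rfl⟩ := hy 1 one_pos
        simp only [Set.mem_ofPred_eq]
        exact_mod_cast hB.sum_bundle_le hn hq
      · refine convex_halfSpace_le (f := fun f : Fin n → ℝ => ∑ i, f i) ⟨fun a b => ?_, fun c a => ?_⟩ _
        · simp [Finset.sum_add_distrib]
        · simp [Finset.mul_sum]
    have := hsub hP
    simp only [Set.mem_ofPred_eq] at this
    exact_mod_cast this
  · rw [hB.demand_eq_bundle hp, Set.mem_singleton_iff] at hP
    rw [hP]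
    exact hB.sum_bundle_le hn hp

theorem demand_nonempty (hB : B.Represents v) (p : Fin n → ℝ) : (v.demand p).Nonempty := by
  obtain ⟨x, hx, hmax⟩ := Set.exists_max_image v.dom (v.net p) v.finite_dom ⟨0, hB.zero_mem⟩
  exact ⟨x, v.mem_demand_iff.2 ⟨hx, hmax⟩⟩

/-- The domain is closed under passing to smaller non-negative vectors. -/
theorem mem_of_le (hB : B.Represents v) {x y : Fin n → ℤ} (hx : x ∈ v.dom) (hy : 0 ≤ y)
    (hyx : y ≤ x) : y ∈ v.dom := by
  have key : ∀ q : Fin n → ℤ, 0 ≤ q → y + q ∈ v.dom → y ∈ v.dom := by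
    refine nonneg_int_induction (by simp) fun q b hq ih hmem => ?_
    refine ih ?_
    have e : y + (q + Pi.single b 1) - Pi.single b 1 = y + q := by abel
    -- In an exchange with the empty bundle, a partner `k` would need a negative entry, so the item
    -- of `b` is simply dropped.
    rcases (hB.mNatConcave 0).exchange _ hmem 0 hB.zero_mem b (by
      have h1 := hy b
      have h2 := hq b
      simp at h1 h2 ⊢; omega) with ⟨h, -⟩ | ⟨k, hk, -⟩
    · rwa [e] at h
    · exact absurd hk (not_lt.2 (v.nonneg_dom _ hmem k))
  exact key (x - y) (sub_nonneg.2 hyx) (by simpa using hx)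

end BidList.Represents

end

/-! ### Steepest ascent. -/

section

variable {n : ℕ} {v : Valuation n} {B : BidList n}

/-- Augmentation moves an item from the larger `y` to `x`. As `x` gains nothing, `y` loses nothing;
and the item has `l k ≤ x k < y k`, so `y` stays above `l`. -/
theorem MNatConcave.exists_sum_le {S : Set (Fin n → ℤ)} {g : (Fin n → ℤ) → ℝ}
    (H : MNatConcave S g) {x l : Fin n → ℤ} (hx : x ∈ S) (hlx : l ≤ x)
    (hloc : ∀ k, x + Pi.single k 1 ∈ S → g (x + Pi.single k 1) ≤ g x) {y : Fin n → ℤ} (hy : y ∈ S)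
    (hly : l ≤ y) : ∃ y' ∈ S, l ≤ y' ∧ y' ≤ y ∧ ∑ i, y' i ≤ ∑ i, x i ∧ g y ≤ g y' := by
  obtain ⟨N, hN⟩ : ∃ N : ℕ, ∑ i, y i ≤ ∑ i, x i + N :=
    ⟨(∑ i, y i - ∑ i, x i).toNat, by omega⟩
  induction N generalizing y with
  | zero => exact ⟨y, hy, hly, le_rfl, by simpa using hN, le_rfl⟩
  | succ N ih =>
    rcases le_or_gt (∑ i, y i) (∑ i, x i) with h | h
    · exact ⟨y, hy, hly, le_rfl, h, le_rfl⟩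
    obtain ⟨k, hk, h1, h2, h3⟩ := H.augment x hx y hy h
    have hle : l ≤ y - Pi.single k 1 := by
      intro j
      by_cases hj : j = k
      · subst hj
        have : l j ≤ x j := hlx j
        simp; omega
      · simpa [hj] using hly j
    obtain ⟨y', hy', hly', hyy, hs, hg⟩ := ih h2 hle (by
      simp [Finset.sum_sub_distrib]
      push_cast at hN; omega)
    exact ⟨y', hy', hly', hyy.trans (sub_le_self _ (Pi.single_nonneg.2 zero_le_one)), hs, by have := hloc k h1; linarith⟩

theorem haltsFrom_evalLift {A : Algorithm n} {p : Fin n → ℝ} {s : A.State} {z : Fin (n + 1) → ℤ}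
    {k : WithBot ℝ → A.State} (hs : A.step s = evalLift p z k) {s' : A.State}
    (hs' : k (mLift (v.utility p) z) = s') {m : ℕ} {x : Fin n → ℤ} (h : A.HaltsFrom v s' m x) : ∃ m' ≤ m + 1, A.HaltsFrom v s m' x := by
  subst hs'
  unfold evalLift at hs
  unfold mLift at h
  split_ifs at hs h with hz
  · exact ⟨m + 1, le_rfl, .ask hs h⟩
  · exact ⟨m, by omega, .compute hs h⟩

theorem haltsFrom_scan (v : Valuation n) (p : Fin n → ℝ) (z : Fin (n + 1) → ℤ) (a : WithBot ℝ)
    (todo : List (Fin (n + 1) × Fin (n + 1))) (best : Fin (n + 1) → ℤ) :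
    ∃ best', (best' = best ∨ ∃ ij ∈ todo, best' = z + Pi.single ij.1 1 - Pi.single ij.2 1) ∧
      mLift (v.utility p) best ≤ mLift (v.utility p) best' ∧
      (∀ ij ∈ todo, mLift (v.utility p) (z + Pi.single ij.1 1 - Pi.single ij.2 1) ≤
        mLift (v.utility p) best') ∧
      ∀ m x, (steepestAscent n).HaltsFrom v
          (AscentState.scan p z a [] best' (mLift (v.utility p) best')) m x →
        ∃ m' ≤ m + todo.length, (steepestAscent n).HaltsFrom v
          (AscentState.scan p z a todo best (mLift (v.utility p) best)) m' x := by
  induction todo generalizing best with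
  | nil => exact ⟨best, Or.inl rfl, le_rfl, by simp, fun m x h => ⟨m, by simp, h⟩⟩
  | cons ij rest ih =>
    set z' := z + Pi.single ij.1 1 - Pi.single ij.2 1 with hz'
    have hstep : (steepestAscent n).step
        (AscentState.scan p z a (ij :: rest) best (mLift (v.utility p) best)) =
        evalLift p z' fun c => if mLift (v.utility p) best < c then .scan p z a rest z' c
          else .scan p z a rest best (mLift (v.utility p) best) := rfl
    by_cases hlt : mLift (v.utility p) best < mLift (v.utility p) z'
    · obtain ⟨best', h1, h2, h3, h4⟩ := ih z'
      refine ⟨best', Or.inr ?_, hlt.le.trans h2, ?_, fun m x h => ?_⟩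
      · rcases h1 with rfl | ⟨ij', h, rfl⟩
        · exact ⟨ij, by simp, rfl⟩
        · exact ⟨ij', by simp [h], rfl⟩
      · simpa using ⟨h2, by simpa using h3⟩
      · obtain ⟨m', hm', hh⟩ := h4 m x h
        obtain ⟨m'', hm'', hh'⟩ := haltsFrom_evalLift hstep (if_pos hlt) hh
        exact ⟨m'', by simp; omega, hh'⟩
    · obtain ⟨best', h1, h2, h3, h4⟩ := ih best
      refine ⟨best', ?_, h2, ?_, fun m x h => ?_⟩
      · rcases h1 with rfl | ⟨ij', h, rfl⟩
        · exact Or.inl rfl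
        · exact Or.inr ⟨ij', by simp [h], rfl⟩
      · simpa using ⟨(not_lt.1 hlt).trans h2, by simpa using h3⟩
      · obtain ⟨m', hm', hh⟩ := h4 m x h
        obtain ⟨m'', hm'', hh'⟩ := haltsFrom_evalLift hstep (if_neg hlt) hh
        exact ⟨m'', by simp; omega, hh'⟩

theorem mem_exchangePairs {i j : Fin (n + 1)} : (i, j) ∈ exchangePairs n ↔ i ≠ j := by
  simp [exchangePairs]

theorem length_exchangePairs_le : (exchangePairs n).length ≤ (n + 1) ^ 2 := by
  refine (List.length_filter_le _ _).trans ?_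
  simp [List.length_product, sq]

theorem mLift_eq_coe (p : Fin n → ℝ) {z : Fin (n + 1) → ℤ} (h0 : z 0 = -∑ i, Fin.tail z i)
    (hz : Fin.tail z ∈ v.dom) : mLift (v.utility p) z = (v.net p (Fin.tail z) : WithBot ℝ) := by
  rw [mLift, if_pos h0, v.utility_eq_coe p hz, Valuation.net]

theorem mem_of_mLift_ne_bot {p : Fin n → ℝ} {z : Fin (n + 1) → ℤ}
    (h : mLift (v.utility p) z ≠ ⊥) : z 0 = -∑ i, Fin.tail z i ∧ Fin.tail z ∈ v.dom := by
  unfold mLift at h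
  split_ifs at h with h0
  · refine ⟨h0, ?_⟩
    by_contra hz
    exact h (v.utility_eq_bot p hz)
  · exact absurd rfl h

theorem tail_add_succ_sub_zero (z : Fin (n + 1) → ℤ) (k : Fin n) :
    Fin.tail (z + Pi.single k.succ 1 - Pi.single 0 1) = Fin.tail z + Pi.single k 1 := by
  conv_lhs => rw [← Fin.cons_self_tail z]
  exact tail_cons_add_sub_zero _ _ _

/-- `hlt` and `heq` form the invariant, and `N` bounds the number of items that can still be added.
A strict improvement must leave the sizes already covered, hence adds exactly one item. -/
theorem steepestAscent_haltsFrom {p : Fin n → ℝ} (H : MNatConcave v.dom (v.net p)) {T : ℤ}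
    (hT : ∀ x ∈ v.dom, ∑ i, x i ≤ T) (N : ℕ) (z : Fin (n + 1) → ℤ)
    (hN : T ≤ ∑ i, Fin.tail z i + N) (h0 : z 0 = -∑ i, Fin.tail z i) (hz : Fin.tail z ∈ v.dom)
    (hlt : ∀ y ∈ v.dom, ∑ i, y i < ∑ i, Fin.tail z i → v.net p y < v.net p (Fin.tail z))
    (heq : ∀ y ∈ v.dom, ∑ i, y i = ∑ i, Fin.tail z i → v.net p y ≤ v.net p (Fin.tail z)) :
    ∃ m x, (steepestAscent n).HaltsFrom v (AscentState.scan p z (mLift (v.utility p) z)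
        (exchangePairs n) z (mLift (v.utility p) z)) m x ∧
      x ∈ v.demand p ∧ m ≤ (N + 1) * (n + 1) ^ 2 := by
  induction N generalizing z with
  | zero =>
    obtain ⟨best, h1, h2, h3, h4⟩ := haltsFrom_scan v p z (mLift (v.utility p) z)
      (exchangePairs n) z
    have hlen := length_exchangePairs_le (n := n)
    have hnlt : ¬ mLift (v.utility p) z < mLift (v.utility p) best := by
      intro hb
      obtain ⟨hb0, hbd⟩ := mem_of_mLift_ne_bot (bot_le.trans_lt hb).ne'
      rw [mLift_eq_coe p h0 hz, mLift_eq_coe p hb0 hbd, WithBot.coe_lt_coe] at hb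
      have := hT _ hbd
      rcases (show ∑ i, Fin.tail best i ≤ ∑ i, Fin.tail z i by simp at hN; omega).lt_or_eq with h | h
      · exact (hlt _ hbd h).not_gt hb
      · exact (heq _ hbd h).not_gt hb
    have hstep : (steepestAscent n).step (AscentState.scan p z (mLift (v.utility p) z) [] best
        (mLift (v.utility p) best)) = .halt (Fin.tail z) := if_neg hnlt
    obtain ⟨m, hm, hh⟩ := h4 0 _ (.halt hstep)
    refine ⟨m, _, hh, v.mem_demand_iff.2 ⟨hz, fun y hy => ?_⟩, by omega⟩
    have := hT y hy
    rcases (show ∑ i, y i ≤ ∑ i, Fin.tail z i by simp at hN; omega).lt_or_eq with h | h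
    · exact (hlt _ hy h).le
    · exact heq _ hy h
  | succ N ih =>
    obtain ⟨best, h1, h2, h3, h4⟩ := haltsFrom_scan v p z (mLift (v.utility p) z)
      (exchangePairs n) z
    have hlen := length_exchangePairs_le (n := n)
    by_cases hb : mLift (v.utility p) z < mLift (v.utility p) best
    · obtain ⟨hb0, hbd⟩ := mem_of_mLift_ne_bot (bot_le.trans_lt hb).ne'
      have hb' := hb
      rw [mLift_eq_coe p h0 hz, mLift_eq_coe p hb0 hbd, WithBot.coe_lt_coe] at hb'
      have hgt : ∑ i, Fin.tail z i < ∑ i, Fin.tail best i := by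
        rcases lt_trichotomy (∑ i, Fin.tail best i) (∑ i, Fin.tail z i) with h | h | h
        · exact absurd hb' (hlt _ hbd h).not_gt
        · exact absurd hb' (heq _ hbd h).not_gt
        · exact h
      have hsum : ∑ i, Fin.tail best i = ∑ i, Fin.tail z i + 1 := by
        rcases h1 with rfl | ⟨⟨i, j⟩, -, hbest⟩
        · omega
        · have := congrFun hbest 0
          rw [hb0] at this
          simp only [Pi.add_apply, Pi.sub_apply, Pi.single_apply, h0] at this
          split_ifs at this <;> omega
      have hle : ∀ y ∈ v.dom, ∑ i, y i ≤ ∑ i, Fin.tail z i → v.net p y ≤ v.net p (Fin.tail z) := by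
        intro y hy h
        rcases h.lt_or_eq with h | h
        · exact (hlt _ hy h).le
        · exact heq _ hy h
      obtain ⟨m, x, hh, hx, hm⟩ := ih best (by rw [hsum]; push_cast at hN; omega) hb0 hbd
        (fun y hy h => (hle y hy (by omega)).trans_lt hb') (fun y hy h => by
          -- Without its item of good `k`, `y` has the current size and does not beat the current
          -- point. So `y` does not beat the neighbour that gains this item, which was scanned.
          obtain ⟨k, hk, e1, e2, e3⟩ := H.augment _ hz y hy (by omega)
          have e4 := hle _ e2 (by simp [Finset.sum_sub_distrib]; omega)
          have e5 := h3 (k.succ, 0) (mem_exchangePairs.2 (Fin.succ_ne_zero k))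
          rw [mLift_eq_coe p hb0 hbd, mLift_eq_coe (v := v) p (by
              rw [tail_add_succ_sub_zero]
              simp [Finset.sum_add_distrib, h0, Pi.single_apply,
                (Fin.succ_ne_zero k).symm]
              omega) (by rw [tail_add_succ_sub_zero]; exact e1),
            WithBot.coe_le_coe, tail_add_succ_sub_zero] at e5
          linarith)
      have hstep : (steepestAscent n).step (AscentState.scan p z (mLift (v.utility p) z) [] best
          (mLift (v.utility p) best)) = .compute (.scan p best (mLift (v.utility p) best)
            (exchangePairs n) best (mLift (v.utility p) best)) := if_pos hb
      obtain ⟨m', hm', hh'⟩ := h4 m x (.compute hstep hh)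
      refine ⟨m', x, hh', hx, ?_⟩
      calc m' ≤ m + (exchangePairs n).length := hm'
        _ ≤ (N + 1) * (n + 1) ^ 2 + (n + 1) ^ 2 := add_le_add hm hlen
        _ = (N + 1 + 1) * (n + 1) ^ 2 := by ring
    · have hstep : (steepestAscent n).step (AscentState.scan p z (mLift (v.utility p) z) [] best
          (mLift (v.utility p) best)) = .halt (Fin.tail z) := if_neg hb
      obtain ⟨m, hm, hh⟩ := h4 0 _ (.halt hstep)
      refine ⟨m, _, hh, v.mem_demand_iff.2 ⟨hz, fun y hy => ?_⟩, by nlinarith⟩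
      have hloc : ∀ k, Fin.tail z + Pi.single k 1 ∈ v.dom →
          v.net p (Fin.tail z + Pi.single k 1) ≤ v.net p (Fin.tail z) := by
        intro k hk
        have e5 := (h3 (k.succ, 0) (mem_exchangePairs.2 (Fin.succ_ne_zero k))).trans (not_lt.1 hb)
        rwa [mLift_eq_coe p h0 hz, mLift_eq_coe (v := v) p (by
              rw [tail_add_succ_sub_zero]
              simp [Finset.sum_add_distrib, h0, Pi.single_apply,
                (Fin.succ_ne_zero k).symm]
              omega) (by rw [tail_add_succ_sub_zero]; exact hk),
            WithBot.coe_le_coe, tail_add_succ_sub_zero] at e5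
      obtain ⟨y', hy', -, -, hs, hg⟩ := H.exists_sum_le hz (v.nonneg_dom _ hz) hloc hy
        (v.nonneg_dom _ hy)
      refine hg.trans ?_
      rcases hs.lt_or_eq with h | h
      · exact (hlt _ hy' h).le
      · exact heq _ hy' h

theorem steepestAscent_halts (hB : B.Represents v) (hn : 1 ≤ n) (p : Fin n → ℝ) :
    ∃ m x, (steepestAscent n).Halts v p m x ∧ x ∈ v.demand p ∧
      (m : ℤ) ≤ (B.numBids * B.maxWeight + 1) * (n + 1) ^ 2 + 1 := by
  have htail : Fin.tail (0 : Fin (n + 1) → ℤ) = 0 := rfl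
  have hW : 0 ≤ (B.numBids : ℤ) * B.maxWeight :=
    mul_nonneg (by positivity) (hB.maxWeight_nonneg hn)
  have hzero : ∀ y ∈ v.dom, ∑ i, y i ≤ 0 → y = 0 := by
    intro y hy h
    ext i
    have h' : ∑ i, y i = 0 := le_antisymm h (Finset.sum_nonneg fun i _ => v.nonneg_dom y hy i)
    exact (Finset.sum_eq_zero_iff_of_nonneg fun i _ => v.nonneg_dom y hy i).1 h' i
      (Finset.mem_univ i)
  obtain ⟨m, x, hh, hx, hm⟩ := steepestAscent_haltsFrom (hB.mNatConcave p)
    (fun x hx => hB.sum_le hn hx) ((B.numBids : ℤ) * B.maxWeight).toNat 0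
    (by simp [htail, Int.toNat_of_nonneg hW]) (by simp [htail]) (by rw [htail]; exact hB.zero_mem)
    (fun y hy h => by
      rw [htail] at h
      have : 0 ≤ ∑ i, y i := Finset.sum_nonneg fun i _ => v.nonneg_dom y hy i
      simp at h; omega)
    (fun y hy h => by
      rw [htail] at h ⊢
      rw [hzero y hy (by simp at h; omega)])
  have hstep : (steepestAscent n).step (AscentState.start p) =
      evalLift p 0 fun a => .scan p 0 a (exchangePairs n) 0 a := rfl
  obtain ⟨m', hm', hh'⟩ := haltsFrom_evalLift hstep rfl hh
  refine ⟨m', x, hh', hx, ?_⟩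
  have : (m' : ℤ) ≤ (((B.numBids : ℤ) * B.maxWeight).toNat + 1) * (n + 1) ^ 2 + 1 := by
    exact_mod_cast hm'.trans (Nat.add_le_add_right hm 1)
  rwa [Int.toNat_of_nonneg hW] at this

end

/-! ### The invariant and the potential of the scaling algorithm. -/

section

variable {n : ℕ} {v : Valuation n} {B : BidList n}

/-- The current point of the scaling algorithm: the lower bound `l`, raised by `2 ^ e i - 1` in the
coordinates `i ∈ J`. -/
def scalingPoint (l : Fin n → ℤ) (J : Finset (Fin n)) (e : Fin n → ℕ) : Fin n → ℤ :=
  fun i => l i + if i ∈ J then 2 ^ e i - 1 else 0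

/-- Decrease the exponent `e m` by one. -/
def lowerScale (e : Fin n → ℕ) (m : Fin n) : Fin n → ℕ := Function.update e m (e m - 1)

/-- The vector that agrees with `x` on the goods up to position `m` in the order of the scales `e`,
and with `l` on the other goods. -/
def prefixPoint (l x : Fin n → ℤ) (e : Fin n → ℕ) (m : Fin n) : Fin n → ℤ :=
  fun j => if (Tuple.sort e).symm j ≤ m then x j else l j

/-- The invariant of the scaling algorithm: some demanded bundle lies above the lower bound `l` and
has at most `K` items, and `h` is an upper bound for all such bundles of the domain. -/
structure ScalingInvariant (v : Valuation n) (p : Fin n → ℝ) (K : ℤ) (h l : Fin n → ℤ)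
    (J : Finset (Fin n)) (e : Fin n → ℕ) : Prop where
  nonneg : 0 ≤ l
  mem : scalingPoint l J e ∈ v.dom
  opt : ∃ y ∈ v.demand p, l ≤ y ∧ ∑ i, y i ≤ K
  bound : ∀ y ∈ v.dom, l ≤ y → ∑ i, y i ≤ K → ∀ i, y i ≤ h i

/-- The potential that drops by at least one in every iteration of the scaling algorithm. -/
def scalingPotential (h l : Fin n → ℤ) (J : Finset (Fin n)) (e : Fin n → ℕ) : ℝ :=
  ∑ i, ((h i - l i : ℤ) : ℝ) / 2 ^ e i + ((n : ℝ) - J.card) + (3 * n + 3) * ∑ i, (e i : ℝ)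

theorem le_scalingPoint (l : Fin n → ℤ) (J : Finset (Fin n)) (e : Fin n → ℕ) :
    l ≤ scalingPoint l J e := by
  intro i
  have : (1 : ℤ) ≤ 2 ^ e i := one_le_pow₀ (by norm_num)
  simp only [scalingPoint]
  split_ifs <;> omega

theorem Valuation.mem_demand_of_le {p : Fin n → ℝ} {x y : Fin n → ℤ} (hy : y ∈ v.demand p)
    (hx : x ∈ v.dom) (h : v.net p y ≤ v.net p x) : x ∈ v.demand p :=
  v.mem_demand_iff.2 ⟨hx, fun z hz => ((v.mem_demand_iff.1 hy).2 z hz).trans h⟩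

theorem Valuation.net_le_of_mem_demand {p : Fin n → ℝ} {x y : Fin n → ℤ} (hy : y ∈ v.demand p)
    (hx : x ∈ v.dom) : v.net p x ≤ v.net p y :=
  (v.mem_demand_iff.1 hy).2 x hx

/-- If adding one item of good `i` to `x` is the best and a strict improvement, then some demanded
bundle has more items of good `i` than `x`. -/
theorem exists_demand_gt {p : Fin n → ℝ} (H : MNatConcave v.dom (v.net p)) {x l : Fin n → ℤ} {K : ℤ}
    (hlx : l ≤ x) {i : Fin n} (hxi : x + Pi.single i 1 ∈ v.dom)
    (himp : x ∈ v.dom → v.net p x < v.net p (x + Pi.single i 1))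
    (hbest : ∀ k, x + Pi.single k 1 ∈ v.dom →
      v.net p (x + Pi.single k 1) ≤ v.net p (x + Pi.single i 1))
    (hopt : ∃ y ∈ v.demand p, l ≤ y ∧ ∑ i, y i ≤ K) :
    ∃ y ∈ v.demand p, l ≤ y ∧ ∑ i, y i ≤ K ∧ x i + 1 ≤ y i := by
  obtain ⟨y, hy, hly, hK⟩ := hopt
  obtain ⟨N, hN⟩ : ∃ N : ℕ, x i + 1 ≤ y i + N := ⟨(x i + 1 - y i).toNat, by omega⟩
  induction N generalizing y with
  | zero => exact ⟨y, hy, hly, hK, by simpa using hN⟩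
  | succ N ih =>
    rcases le_or_gt (x i + 1) (y i) with h | h
    · exact ⟨y, hy, hly, hK, h⟩
    have hyd := (v.mem_demand_iff.1 hy).1
    -- Exchange without a partner contradicts the strict improvement. With a partner `k`, the choice
    -- of `i` makes `y` plus `i` minus `k` optimal again, one item closer to the goal.
    rcases H.exchange _ hxi y hyd i (by simpa using h) with ⟨h1, h2, h3⟩ | ⟨k, hk, h1, h2, h3⟩
    · rw [add_sub_cancel_right] at h1 h3
      have := himp h1
      have := v.net_le_of_mem_demand hy h2
      linarith
    · rw [add_sub_cancel_right] at h1 h3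
      have := hbest k h1
      have hki : k ≠ i := by rintro rfl; simp at hk; omega
      have hk' : x k < y k := by simpa [hki] using hk
      refine ih (y + Pi.single i 1 - Pi.single k 1)
        (v.mem_demand_of_le hy h2 (by linarith)) ?_ ?_ ?_
      · intro j
        have h4 : l j ≤ y j := hly j
        have h5 : l k ≤ x k := hlx k
        by_cases hj : j = k
        · subst hj; simp [hki]; omega
        · simp only [Pi.add_apply, Pi.sub_apply, Pi.single_apply, hj, if_false]
          split_ifs <;> omega
      · simpa [Finset.sum_add_distrib] using hK
      · push_cast at hN
        simp [hki.symm]; omega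

/-- Otherwise `l` with good `m` raised to `y m` is feasible and larger than `z` plus fewer than `c`
items of `m`. It exceeds `z` at most in good `m`, so augmentation could add all `c` items. -/
theorem lt_of_not_mem_dom (hB : B.Represents v) {l z y : Fin n → ℤ} {m : Fin n} {c : ℕ}
    (hl : 0 ≤ l) (hlz : l ≤ z) (hz : z ∈ v.dom) (hzc : z + Pi.single m (c : ℤ) ∉ v.dom)
    (hy : y ∈ v.dom) (hly : l ≤ y) : y m - l m < ∑ i, (z i - l i) + c := by
  by_contra! hle
  have hw : l + Pi.single m (y m - l m) ∈ v.dom := by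
    refine hB.mem_of_le hy ?_ ?_
    · intro j
      have h1 : 0 ≤ l j := hl j
      have h2 : l m ≤ y m := hly m
      by_cases hj : j = m
      · subst hj; simp; omega
      · simpa [hj] using h1
    · intro j
      by_cases hj : j = m
      · subst hj; simp
      · simpa [hj] using hly j
  have key : ∀ t : ℕ, t ≤ c → z + Pi.single m (t : ℤ) ∈ v.dom := by
    intro t
    induction t with
    | zero => intro _; simpa using hz
    | succ t ih =>
      intro ht
      obtain ⟨k, hk, h1, -⟩ := (hB.mNatConcave 0).augment _ (ih (by omega)) _ hw (by
        simp only [Pi.add_apply, Finset.sum_add_distrib, Finset.sum_pi_single',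
          Finset.sum_sub_distrib] at hle ⊢
        simp
        omega)
      have hkm : k = m := by
        by_contra hkm
        have : l k ≤ z k := hlz k
        simp [hkm] at hk
        omega
      subst hkm
      rw [add_assoc, ← Pi.single_add] at h1
      exact_mod_cast h1
  exact hzc (key c le_rfl)

theorem scalingPotential_nonneg {p : Fin n → ℝ} {K : ℤ} {h l : Fin n → ℤ} {J : Finset (Fin n)}
    {e : Fin n → ℕ} (hI : ScalingInvariant v p K h l J e) : 0 ≤ scalingPotential h l J e := by
  obtain ⟨y, hy, hly, hK⟩ := hI.opt
  have hlh : ∀ i, l i ≤ h i := fun i =>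
    (hly i).trans (hI.bound y (v.mem_demand_iff.1 hy).1 hly hK i)
  have h1 : 0 ≤ ∑ i, ((h i - l i : ℤ) : ℝ) / 2 ^ e i := Finset.sum_nonneg fun i _ => by
    have : (0 : ℝ) ≤ ((h i - l i : ℤ) : ℝ) := by exact_mod_cast sub_nonneg.2 (hlh i)
    positivity
  have h2 : (J.card : ℝ) ≤ n := by exact_mod_cast card_finset_fin_le J
  unfold scalingPotential
  have h3 : (0 : ℝ) ≤ (3 * n + 3) * ∑ i, (e i : ℝ) := by positivity
  linarith

namespace ScalingInvariant

variable {p : Fin n → ℝ} {K : ℤ} {h l : Fin n → ℤ} {J : Finset (Fin n)} {e : Fin n → ℕ}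

/-- Emptying `J` returns the current point to `l`, which is feasible because it lies below a
demanded bundle. -/
theorem lower (hI : ScalingInvariant v p K h l J e) (hB : B.Represents v) {K' : ℤ} {m : Fin n}
    (hm : 1 ≤ e m) (hK : K' ≤ K) (hopt : ∃ y ∈ v.demand p, l ≤ y ∧ ∑ i, y i ≤ K')
    (hbd : ∀ y ∈ v.dom, l ≤ y → ∑ i, y i ≤ K' → y m ≤ l m + (n + 1) * 2 ^ e m) :
    ∃ h', ScalingInvariant v p K' h' l ∅ (lowerScale e m) ∧
      scalingPotential h' l ∅ (lowerScale e m) ≤ scalingPotential h l J e - 1 := by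
  refine ⟨Function.update h m (l m + (n + 1) * 2 ^ e m), ⟨hI.nonneg, ?_, hopt, ?_⟩, ?_⟩
  · obtain ⟨y, hy, hly, -⟩ := hopt
    have : scalingPoint l ∅ (lowerScale e m) = l := by ext i; simp [scalingPoint]
    rw [this]
    exact hB.mem_of_le (v.mem_demand_iff.1 hy).1 hI.nonneg hly
  · intro y hy hly hs i
    by_cases hi : i = m
    · subst hi
      simpa using hbd y hy hly hs
    · simpa [hi] using hI.bound y hy hly (hs.trans hK) i
  · have hlh : l m ≤ h m := by
      obtain ⟨y, hy, hly, hs⟩ := hI.opt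
      exact (hly m).trans (hI.bound y (v.mem_demand_iff.1 hy).1 hly hs m)
    obtain ⟨d, hd⟩ : ∃ d, e m = d + 1 := ⟨e m - 1, by omega⟩
    have h2 : (J.card : ℝ) ≤ n := by exact_mod_cast card_finset_fin_le J
    have hterm : (0 : ℝ) ≤ ((h m - l m : ℤ) : ℝ) / 2 ^ e m := by
      have : (0 : ℝ) ≤ ((h m - l m : ℤ) : ℝ) := by exact_mod_cast sub_nonneg.2 hlh
      positivity
    unfold scalingPotential
    rw [← Finset.add_sum_erase _ _ (Finset.mem_univ m), ← Finset.add_sum_erase _ _ (Finset.mem_univ m),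
      ← Finset.add_sum_erase Finset.univ (fun i => ((h i - l i : ℤ) : ℝ) / 2 ^ e i)
        (Finset.mem_univ m),
      ← Finset.add_sum_erase Finset.univ (fun i => (e i : ℝ)) (Finset.mem_univ m)]
    have e1 : ∑ i ∈ Finset.univ.erase m,
        ((Function.update h m (l m + (n + 1) * 2 ^ e m) i - l i : ℤ) : ℝ) / 2 ^ lowerScale e m i =
        ∑ i ∈ Finset.univ.erase m, ((h i - l i : ℤ) : ℝ) / 2 ^ e i := by
      refine Finset.sum_congr rfl fun i hi => ?_
      have : i ≠ m := Finset.ne_of_mem_erase hi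
      simp [lowerScale, this]
    have e2 : ∑ i ∈ Finset.univ.erase m, ((lowerScale e m i : ℕ) : ℝ) =
        ∑ i ∈ Finset.univ.erase m, (e i : ℝ) := by
      refine Finset.sum_congr rfl fun i hi => ?_
      have : i ≠ m := Finset.ne_of_mem_erase hi
      simp [lowerScale, this]
    have e3 : ((Function.update h m (l m + (n + 1) * 2 ^ e m) m - l m : ℤ) : ℝ) /
        2 ^ lowerScale e m m = 2 * (n + 1) := by
      simp only [lowerScale, Function.update_self, hd]
      push_cast
      field_simp
      simp [pow_succ]
      ring
    have e4 : ((lowerScale e m m : ℕ) : ℝ) = (e m : ℝ) - 1 := by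
      simp [lowerScale, hd]
    rw [e1, e2, e3, e4]
    simp only [Finset.card_empty, Nat.cast_zero]
    -- Emptying `J` costs at most `n` and the new term of good `m` is `2 * (n + 1)`, while the drop
    -- of `e m` gains `3 * n + 3`: a net loss of at least one.
    nlinarith

/-- If `i ∉ J`, then `l i` moves by one only and the growth of `J` pays for it; if `i ∈ J`, then `l
i` moves by a full step and its own term pays. -/
theorem raise (hI : ScalingInvariant v p K h l J e) {i : Fin n}
    (hmem : scalingPoint l J e + Pi.single i (2 ^ e i) ∈ v.dom)
    (hopt : ∃ y ∈ v.demand p, l ≤ y ∧ ∑ i, y i ≤ K ∧ scalingPoint l J e i + 1 ≤ y i) :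
    ScalingInvariant v p K h (Function.update l i (scalingPoint l J e i + 1)) (insert i J) e ∧
      scalingPotential h (Function.update l i (scalingPoint l J e i + 1)) (insert i J) e ≤
        scalingPotential h l J e - 1 ∧
      ∑ j, l j + 1 ≤ ∑ j, Function.update l i (scalingPoint l J e i + 1) j := by
  have hlx := le_scalingPoint l J e
  have hll : l ≤ Function.update l i (scalingPoint l J e i + 1) := by
    intro j
    by_cases hj : j = i
    · subst hj
      have : l j ≤ scalingPoint l J e j := hlx j
      simp; omega
    · simp [hj]
  refine ⟨⟨hI.nonneg.trans hll, ?_, ?_, fun y hy hly => hI.bound y hy (hll.trans hly)⟩, ?_, ?_⟩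
  · convert hmem using 1
    ext j
    by_cases hj : j = i
    · subst hj; simp [scalingPoint]
    · simp [scalingPoint, hj]
  · obtain ⟨y, hy, hly, hs, hyi⟩ := hopt
    refine ⟨y, hy, fun j => ?_, hs⟩
    by_cases hj : j = i
    · subst hj; simpa using hyi
    · simpa [hj] using hly j
  · unfold scalingPotential
    rw [← Finset.add_sum_erase _ _ (Finset.mem_univ i),
      ← Finset.add_sum_erase Finset.univ (fun i => ((h i - l i : ℤ) : ℝ) / 2 ^ e i)
        (Finset.mem_univ i)]
    have e1 : ∑ j ∈ Finset.univ.erase i,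
        ((h j - Function.update l i (scalingPoint l J e i + 1) j : ℤ) : ℝ) / 2 ^ e j =
        ∑ j ∈ Finset.univ.erase i, ((h j - l j : ℤ) : ℝ) / 2 ^ e j := by
      refine Finset.sum_congr rfl fun j hj => ?_
      have : j ≠ i := Finset.ne_of_mem_erase hj
      simp [this]
    rw [e1, Function.update_self]
    have hpow : (0 : ℝ) < 2 ^ e i := by positivity
    by_cases hi : i ∈ J
    · have e2 : ((h i - (scalingPoint l J e i + 1) : ℤ) : ℝ) / 2 ^ e i =
          ((h i - l i : ℤ) : ℝ) / 2 ^ e i - 1 := by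
        simp only [scalingPoint, hi, if_true]
        push_cast
        field_simp
        ring
      rw [e2, Finset.insert_eq_of_mem hi]
      linarith
    · have e2 : ((h i - (scalingPoint l J e i + 1) : ℤ) : ℝ) / 2 ^ e i ≤
          ((h i - l i : ℤ) : ℝ) / 2 ^ e i := by
        refine div_le_div_of_nonneg_right ?_ hpow.le
        simp only [scalingPoint, hi, if_false]
        push_cast
        linarith
      rw [Finset.card_insert_of_notMem hi, Nat.cast_add, Nat.cast_one]
      linarith
  · rw [← Finset.add_sum_erase Finset.univ l (Finset.mem_univ i),
      ← Finset.add_sum_erase Finset.univ (Function.update l i _) (Finset.mem_univ i)]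
    have e1 : ∑ j ∈ Finset.univ.erase i, Function.update l i (scalingPoint l J e i + 1) j =
        ∑ j ∈ Finset.univ.erase i, l j := by
      refine Finset.sum_congr rfl fun j hj => ?_
      have : j ≠ i := Finset.ne_of_mem_erase hj
      simp [this]
    have : l i ≤ scalingPoint l J e i := hlx i
    rw [e1, Function.update_self]
    omega

theorem sum_scalingPoint_le (l : Fin n → ℤ) (J : Finset (Fin n)) {m : Fin n}
    (hm : ∀ j, e j ≤ e m) :
    ∑ i, scalingPoint l J e i ≤ ∑ i, l i + n * 2 ^ e m := by
  simp only [scalingPoint, Finset.sum_add_distrib]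
  refine add_le_add_right ?_ _
  have : ∀ i ∈ (Finset.univ : Finset (Fin n)), (if i ∈ J then 2 ^ e i - 1 else 0 : ℤ) ≤ 2 ^ e m := by
    intro i _
    have h1 : (2 : ℤ) ^ e i ≤ 2 ^ e m := pow_le_pow_right₀ (by norm_num) (hm i)
    have h2 : (0 : ℤ) < 2 ^ e m := by positivity
    split_ifs <;> omega
  simpa using Finset.sum_le_card_nsmul _ _ _ this

/-- If no single item improves the current point, then some demanded bundle is close to it. -/
theorem local_max (hI : ScalingInvariant v p K h l J e) (H : MNatConcave v.dom (v.net p))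
    (hloc : ∀ k, scalingPoint l J e + Pi.single k 1 ∈ v.dom →
      v.net p (scalingPoint l J e + Pi.single k 1) ≤ v.net p (scalingPoint l J e)) :
    ∃ y ∈ v.demand p, l ≤ y ∧ ∑ i, y i ≤ min K (∑ i, scalingPoint l J e i) := by
  obtain ⟨y, hy, hly, hK⟩ := hI.opt
  obtain ⟨y', hy', hly', hyy, hs, hg⟩ := H.exists_sum_le hI.mem (le_scalingPoint l J e) hloc
    (v.mem_demand_iff.1 hy).1 hly
  exact ⟨y', v.mem_demand_of_le hy hy' hg, hly',
    le_min ((Finset.sum_le_sum fun i _ => hyy i).trans hK) hs⟩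

/-- With unit steps the current point is `l` itself, and a demanded bundle above `l` with no more
items equals `l`. -/
theorem mem_demand_of_local_max (hI : ScalingInvariant v p K h l J e)
    (H : MNatConcave v.dom (v.net p)) (he : ∀ j, e j = 0)
    (hloc : ∀ k, scalingPoint l J e + Pi.single k 1 ∈ v.dom →
      v.net p (scalingPoint l J e + Pi.single k 1) ≤ v.net p (scalingPoint l J e)) :
    scalingPoint l J e ∈ v.demand p := by
  obtain ⟨y, hy, hly, hs⟩ := hI.local_max H hloc
  have hx : scalingPoint l J e = l := by ext i; simp [scalingPoint, he]
  rw [hx] at hs ⊢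
  have : l = y := by
    by_contra hne
    obtain ⟨i, hi⟩ := Function.ne_iff.1 hne
    have := Finset.sum_lt_sum (fun i _ => hly i) ⟨i, Finset.mem_univ i, lt_of_le_of_ne (hly i) hi⟩
    have := hs.trans (min_le_right _ _)
    omega
  rwa [this]

/-- As `m` has the largest step, the current point exceeds `l` by at most `n * 2 ^ e m` in total.
Some demanded bundle is no larger, and `K` is tightened accordingly. -/
theorem lower_of_local_max (hI : ScalingInvariant v p K h l J e) (hB : B.Represents v)
    (hloc : ∀ k, scalingPoint l J e + Pi.single k 1 ∈ v.dom →
      v.net p (scalingPoint l J e + Pi.single k 1) ≤ v.net p (scalingPoint l J e)) {m : Fin n}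
    (hm : ∀ j, e j ≤ e m) (hne : ¬ ∀ j, e j = 0) :
    ∃ K' h', ScalingInvariant v p K' h' l ∅ (lowerScale e m) ∧
      scalingPotential h' l ∅ (lowerScale e m) ≤ scalingPotential h l J e - 1 := by
  have hem : 1 ≤ e m := by
    push Not at hne
    obtain ⟨j, hj⟩ := hne
    have := hm j
    omega
  refine ⟨_, hI.lower hB hem (min_le_left _ _) (hI.local_max (hB.mNatConcave p) hloc) ?_⟩
  intro y hy hly hs
  have h1 := hs.trans (min_le_right _ _)
  have h2 := sum_scalingPoint_le l J hm
  have h3 : y m - l m ≤ ∑ i, (y i - l i) :=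
    Finset.single_le_sum (f := fun i => y i - l i) (fun i _ => sub_nonneg.2 (hly i))
      (Finset.mem_univ m)
  rw [Finset.sum_sub_distrib] at h3
  have h4 : (0 : ℤ) < 2 ^ e m := by positivity
  linarith

/-- Goods enter by increasing step, so the first infeasible prefix involves only steps up to that of
its last good. It exceeds `l` by at most `n + 1` such steps, one of them for the jump at `i`, and
`lt_of_not_mem_dom` caps that good. -/
theorem lower_of_infeasible (hI : ScalingInvariant v p K h l J e) (hB : B.Represents v) {i : Fin n}
    (hi : scalingPoint l J e + Pi.single i 1 ∈ v.dom) {m : Fin n}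
    (hm : prefixPoint l (scalingPoint l J e + Pi.single i (2 ^ e i)) e m ∉ v.dom)
    (hlt : ∀ m' < m, prefixPoint l (scalingPoint l J e + Pi.single i (2 ^ e i)) e m' ∈ v.dom) :
    1 ≤ e (Tuple.sort e m) ∧ ∃ h', ScalingInvariant v p K h' l ∅ (lowerScale e (Tuple.sort e m)) ∧
      scalingPotential h' l ∅ (lowerScale e (Tuple.sort e m)) ≤ scalingPotential h l J e - 1 := by
  set x := scalingPoint l J e with hx
  set σ := Tuple.sort e with hσ
  have hlx : l ≤ x := le_scalingPoint l J e
  have hmono : Monotone (e ∘ σ) := Tuple.monotone_sort e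
  have hle : ∀ j, σ.symm j ≤ m → e j ≤ e (σ m) := by
    intro j hj
    simpa using hmono hj
  have hpos : ∀ j, (0 : ℤ) < 2 ^ e j := fun j => by positivity
  have hlx' : l ≤ x + Pi.single i (2 ^ e i) :=
    hlx.trans (le_add_of_nonneg_right (Pi.single_nonneg.2 (hpos i).le))
  -- If this step were one, so would be all steps in the prefix, which would then lie below the
  -- feasible point `x + Pi.single i 1`.
  have hem : 1 ≤ e (σ m) := by
    by_contra! h0
    refine hm (hB.mem_of_le hi ?_ ?_)
    · intro j
      have h1 : 0 ≤ l j := hI.nonneg j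
      have h2 : l j ≤ (x + Pi.single i (2 ^ e i) : Fin n → ℤ) j := hlx' j
      simp only [prefixPoint]
      split_ifs
      · exact h1.trans h2
      · exact h1
    · intro j
      have h2 : l j ≤ x j := hlx j
      simp only [prefixPoint]
      split_ifs with hj
      · have h3 : e j = 0 := by have := hle j hj; omega
        by_cases hji : j = i
        · subst hji; simp [h3]
        · simp [hji]
      · exact h2.trans ((le_add_of_nonneg_right (a := x) (Pi.single_nonneg.2 zero_le_one)) j)
  refine ⟨hem, hI.lower hB hem le_rfl hI.opt ?_⟩
  intro y hy hly hs
  let z : Fin n → ℤ := fun j => if σ.symm j < m then (x + Pi.single i (2 ^ e i) : Fin n → ℤ) j else l j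
  have hlz : l ≤ z := by
    intro j
    simp only [z]
    split_ifs
    · exact hlx' j
    · exact le_rfl
  have hz : z ∈ v.dom := by
    by_cases h0 : (m : ℕ) = 0
    · have : z = l := by
        ext j
        simp only [z]
        rw [if_neg]
        intro hj
        have : ((σ.symm j : Fin n) : ℕ) < m := hj
        omega
      rw [this]
      exact hB.mem_of_le hI.mem hI.nonneg hlx
    · have hpred : (⟨m - 1, by omega⟩ : Fin n) < m := by
        rw [Fin.lt_def]
        simp only
        omega
      have := hlt _ hpred
      convert this using 1
      ext j
      simp only [z, prefixPoint]
      refine if_congr ?_ rfl rfl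
      rw [Fin.lt_def, Fin.le_def, ← hσ]
      simp only
      omega
  obtain ⟨c, hc⟩ : ∃ c : ℕ, (x + Pi.single i (2 ^ e i) : Fin n → ℤ) (σ m) - l (σ m) = c :=
    Int.eq_ofNat_of_zero_le (sub_nonneg.2 (hlx' (σ m)))
  have hzc : z + Pi.single (σ m) (c : ℤ) =
      prefixPoint l (x + Pi.single i (2 ^ e i)) e m := by
    ext j
    simp only [prefixPoint, ← hσ]
    by_cases hj : j = σ m
    · subst hj
      simp only [Pi.add_apply, Pi.single_eq_same, ← hc]
      simp [z]
    · have hne : σ.symm j ≠ m := by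
        rintro rfl; simp at hj
      simp only [Pi.add_apply, Pi.single_apply, hj, if_false, add_zero, z, hne.le_iff_lt]
  have hbd := lt_of_not_mem_dom hB hI.nonneg hlz hz (by rw [hzc]; exact hm) hy hly
  have hsum : ∑ j, (z j - l j) + c = ∑ j, ((z + Pi.single (σ m) (c : ℤ) : Fin n → ℤ) j - l j) := by
    simp only [Pi.add_apply, Finset.sum_sub_distrib, Finset.sum_add_distrib, Finset.sum_pi_single']
    simp
    ring
  have hterm : ∀ j ∈ (Finset.univ : Finset (Fin n)), (z + Pi.single (σ m) (c : ℤ) : Fin n → ℤ) j - l j ≤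
      2 ^ e (σ m) + if j = i then 2 ^ e (σ m) else 0 := by
    intro j _
    rw [hzc]
    simp only [prefixPoint, ← hσ]
    have h0 := hpos (σ m)
    split_ifs with hj hji hji
    · subst hji
      have h1 : (2 : ℤ) ^ e j ≤ 2 ^ e (σ m) := pow_le_pow_right₀ (by norm_num) (hle j hj)
      have h2 := hpos j
      simp only [hx, Pi.add_apply, scalingPoint, Pi.single_eq_same]
      split_ifs <;> omega
    · have h1 : (2 : ℤ) ^ e j ≤ 2 ^ e (σ m) := pow_le_pow_right₀ (by norm_num) (hle j hj)
      simp only [hx, Pi.add_apply, scalingPoint, Pi.single_apply, hji, if_false]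
      split_ifs <;> omega
    · omega
    · omega
  have := Finset.sum_le_sum hterm
  rw [← hsum, Finset.sum_add_distrib, Finset.sum_const, Finset.card_univ, Fintype.card_fin,
    Finset.sum_ite_eq' ] at this
  simp at this
  rw [Finset.sum_sub_distrib] at hbd
  linarith

end ScalingInvariant

end

/-! ### The scaling algorithm as a loop of query trees. -/

section

variable {n : ℕ}

/-- A finite decision tree of value queries with results in `α`. -/
inductive Query (n : ℕ) (α : Type) : Type where
  | ret (a : α)
  | ask (x : Fin n → ℤ) (k : WithBot ℝ → Query n α)

/-- Query all the bundles of a finite family and pass the table of their values on. -/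
def Query.askAll {α : Type} : {m : ℕ} → (Fin m → Fin n → ℤ) →
    ((Fin m → WithBot ℝ) → Query n α) → Query n α
  | 0, _, k => k Fin.elim0
  | _ + 1, f, k => .ask (f 0) fun a => askAll (Fin.tail f) fun t => k (Fin.cons a t)

/-- The algorithm that runs the query tree `body s` in state `s`, until it yields an output. -/
def loopAlgorithm {σ : Type} (init : (Fin n → ℝ) → σ) (body : σ → Query n (σ ⊕ (Fin n → ℤ))) :
    Algorithm n where
  State := Query n (σ ⊕ (Fin n → ℤ))
  init p := .ret (.inl (init p))
  step
    | .ret (.inl s) => .compute (body s)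
    | .ret (.inr x) => .halt x
    | .ask x k => .ask x k

variable {v : Valuation n} {B : BidList n}

theorem haltsFrom_askAll {σ : Type} {init : (Fin n → ℝ) → σ} {body : σ → Query n (σ ⊕ (Fin n → ℤ))}
    {N : ℕ} (f : Fin N → Fin n → ℤ) (k : (Fin N → WithBot ℝ) → Query n (σ ⊕ (Fin n → ℤ))) {m : ℕ}
    {x : Fin n → ℤ}
    (h : (loopAlgorithm init body).HaltsFrom v (k fun i => v.val (f i)) m x) :
    (loopAlgorithm init body).HaltsFrom v (Query.askAll f k) (m + N) x := by
  induction N with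
  | zero =>
    have : (fun i => v.val (f i)) = Fin.elim0 := funext fun i => i.elim0
    rw [this] at h
    exact h
  | succ N ih =>
    refine Algorithm.HaltsFrom.ask (A := loopAlgorithm init body) (m := m + N) rfl (ih _ _ ?_)
    have : (Fin.cons (v.val (f 0)) fun i => v.val (Fin.tail f i) : Fin (N + 1) → WithBot ℝ) =
        fun i => v.val (f i) := by
      ext i
      refine Fin.cases ?_ (fun i => ?_) i <;> simp [Fin.tail]
    rw [this]
    exact h

/-- States of the scaling algorithm: searching for the initial scale, and the main loop. -/
inductive ScalingState (n : ℕ) where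
  | search (p : Fin n → ℝ) (k : ℕ)
  | run (p : Fin n → ℝ) (l : Fin n → ℤ) (J : Finset (Fin n)) (e : Fin n → ℕ)

/-- A position of a largest entry. -/
def argmax [NeZero n] {α : Type*} [LinearOrder α] (t : Fin n → α) : Fin n :=
  Classical.choose (Finite.exists_max t)

theorem le_argmax [NeZero n] {α : Type*} [LinearOrder α] (t : Fin n → α) (j : Fin n) :
    t j ≤ t (argmax t) := Classical.choose_spec (Finite.exists_max t) j

theorem exists_first_bot {t : Fin n → WithBot ℝ} (h : ∃ m, t m = ⊥) :
    ∃ m, t m = ⊥ ∧ ∀ m' < m, t m' ≠ ⊥ := by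
  obtain ⟨m, hm, hmin⟩ := WellFounded.has_min (wellFounded_lt (α := Fin n)) {m | t m = ⊥} h
  exact ⟨m, hm, fun m' hm' h' => hmin m' h' hm'⟩

open Classical in
/-- One iteration of the scaling algorithm. -/
def scalingBody [NeZero n] : ScalingState n → Query n (ScalingState n ⊕ (Fin n → ℤ))
  | .search p k =>
    Query.askAll (fun i : Fin n => Pi.single i (4 * n * 2 ^ k)) fun t =>
      .ret <| .inl <| if ∀ i, t i = ⊥ then .run p 0 ∅ fun _ => k else .search p (k + 1)
  | .run p l J e =>
    let x := scalingPoint l J e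
    Query.askAll (Fin.cons x fun i => x + Pi.single i 1 : Fin (n + 1) → Fin n → ℤ) fun t =>
      let u : Fin n → WithBot ℝ := fun i => utilityOfValue p (x + Pi.single i 1) (t i.succ)
      let i := argmax u
      if u i ≤ utilityOfValue p x (t 0) then
        .ret <| if ∀ j, e j = 0 then .inr x else .inl <| .run p l ∅ (lowerScale e (argmax e))
      else
        Query.askAll (prefixPoint l (x + Pi.single i (2 ^ e i)) e) fun t' =>
          .ret <| .inl <| if h : ∃ m, t' m = ⊥ then
            .run p l ∅ (lowerScale e (Tuple.sort e (Classical.choose (exists_first_bot h))))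
          else .run p (Function.update l i (x i + 1)) (insert i J) e

/-- The scaling algorithm. -/
def scalingAlgorithm (n : ℕ) [NeZero n] : Algorithm n :=
  loopAlgorithm (fun p => ScalingState.search p 0) scalingBody

/-- `HaltsWithin v s N x`: from the state `s` of its loop, the scaling algorithm halts with output
`x` after at most `N` queries. -/
def HaltsWithin [NeZero n] (v : Valuation n) (s : ScalingState n) (N : ℕ) (x : Fin n → ℤ) : Prop :=
  ∃ m ≤ N, (scalingAlgorithm n).HaltsFrom v (Query.ret (Sum.inl s)) m x

/-- Hence the jump is feasible when no prefix is infeasible. -/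
theorem prefixPoint_last [NeZero n] (l x : Fin n → ℤ) (e : Fin n → ℕ) :
    prefixPoint l x e (Fin.rev 0) = x := by
  ext j
  have : (Tuple.sort e).symm j ≤ Fin.rev 0 := by
    rw [Fin.le_def, Fin.val_rev]
    have := ((Tuple.sort e).symm j).2
    simp
    omega
  rw [prefixPoint, if_pos this]

/-- `K` and `h` live only in the analysis. An iteration costs `n + 1` queries for the point and its
neighbours and at most `n` for the prefixes. The clause on zero exponents is for
`haltsWithin_of_scale_one`. -/
theorem scalingBody_run [NeZero n] (hB : B.Represents v) {p : Fin n → ℝ} {K : ℤ} {h l : Fin n → ℤ}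
    {J : Finset (Fin n)} {e : Fin n → ℕ} (hI : ScalingInvariant v p K h l J e) :
    (∃ x ∈ v.demand p, HaltsWithin v (.run p l J e) (2 * n + 1) x) ∨
    ∃ K' h' l' J' e', ScalingInvariant v p K' h' l' J' e' ∧
      scalingPotential h' l' J' e' ≤ scalingPotential h l J e - 1 ∧
      ((∀ j, e j = 0) → K' = K ∧ (∀ j, e' j = 0) ∧ ∑ j, l j + 1 ≤ ∑ j, l' j) ∧
      ∀ N x, HaltsWithin v (.run p l' J' e') N x →
        HaltsWithin v (.run p l J e) (N + (2 * n + 1)) x := by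
  classical
  set x := scalingPoint l J e with hx
  set u : Fin n → WithBot ℝ := fun i => v.utility p (x + Pi.single i 1) with hu
  set i := argmax u with hi
  set x' : Fin n → ℤ := x + Pi.single i (2 ^ e i) with hx'
  have hu' : ∀ k, u k = v.utility p (x + Pi.single k 1) := fun _ => rfl
  have hux : v.utility p x = (v.net p x : WithBot ℝ) := v.utility_eq_coe p hI.mem
  have key : ∀ (q : Query n (ScalingState n ⊕ (Fin n → ℤ))),
      (if u i ≤ v.utility p x then
        Query.ret <| if ∀ j, e j = 0 then .inr x else .inl <| .run p l ∅ (lowerScale e (argmax e))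
      else
        Query.askAll (prefixPoint l x' e) fun t' =>
          .ret <| .inl <| if h : ∃ m, t' m = ⊥ then
            .run p l ∅ (lowerScale e (Tuple.sort e (Classical.choose (exists_first_bot h))))
          else .run p (Function.update l i (x i + 1)) (insert i J) e) = q →
      ∀ m y, (scalingAlgorithm n).HaltsFrom v q m y →
        (scalingAlgorithm n).HaltsFrom v (Query.ret (Sum.inl (.run p l J e))) (m + (n + 1)) y := by
    intro q hq m y hy
    refine Algorithm.HaltsFrom.compute (A := scalingAlgorithm n)
      (s' := scalingBody (.run p l J e)) rfl ?_
    refine haltsFrom_askAll _ _ ?_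
    subst hq
    exact hy
  by_cases hle : u i ≤ v.utility p x
  · have hloc : ∀ k, x + Pi.single k 1 ∈ v.dom → v.net p (x + Pi.single k 1) ≤ v.net p x := by
      intro k hk
      have := (le_argmax u k).trans hle
      rwa [hux, hu', v.utility_eq_coe p hk, WithBot.coe_le_coe] at this
    by_cases he : ∀ j, e j = 0
    · refine Or.inl ⟨x, hI.mem_demand_of_local_max (hB.mNatConcave p) he hloc, 0 + (n + 1), by omega,
        key (.ret (.inr x)) (by rw [if_pos hle, if_pos he]) _ _ ?_⟩
      exact Algorithm.HaltsFrom.halt (A := scalingAlgorithm n) rfl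
    · obtain ⟨K', h', hI', hpot⟩ := hI.lower_of_local_max hB hloc (le_argmax e) he
      refine Or.inr ⟨K', h', l, ∅, _, hI', hpot, fun h0 => absurd h0 he, ?_⟩
      rintro N y ⟨m, hm, hy⟩
      exact ⟨m + (n + 1), by omega, key _ (by rw [if_pos hle, if_neg he]) _ _ hy⟩
  · have hlt := not_le.1 hle
    have hxi : x + Pi.single i 1 ∈ v.dom := by
      by_contra hnot
      have : u i = ⊥ := v.utility_eq_bot p hnot
      simp [this] at hlt
    have hui : u i = (v.net p (x + Pi.single i 1) : WithBot ℝ) := v.utility_eq_coe p hxi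
    have key' : ∀ s : ScalingState n,
        (if h : ∃ m, v.val (prefixPoint l x' e m) = ⊥ then
          .run p l ∅ (lowerScale e (Tuple.sort e (Classical.choose
            (exists_first_bot (t := fun m => v.val (prefixPoint l x' e m)) h))))
          else .run p (Function.update l i (x i + 1)) (insert i J) e) = s →
        ∀ N y, HaltsWithin v s N y → HaltsWithin v (.run p l J e) (N + (2 * n + 1)) y := by
      rintro s hs N y ⟨m, hm, hy⟩
      refine ⟨m + n + (n + 1), by omega, key _ (if_neg hle) _ _ ?_⟩
      refine haltsFrom_askAll _ _ ?_
      subst hs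
      exact hy
    by_cases hbot : ∃ m, v.val (prefixPoint l x' e m) = ⊥
    · have hspec := Classical.choose_spec
        (exists_first_bot (t := fun m => v.val (prefixPoint l x' e m)) hbot)
      obtain ⟨hem, h', hI', hpot⟩ := hI.lower_of_infeasible hB hxi
        (fun hmem => hmem hspec.1) hspec.2
      exact Or.inr ⟨K, h', l, ∅, _, hI', hpot, fun h0 => by rw [h0] at hem; omega,
        key' _ (dif_pos hbot)⟩
    · have hmem : x' ∈ v.dom := fun h0 => hbot ⟨Fin.rev 0, by rwa [prefixPoint_last]⟩
      have hbest : ∀ k, x + Pi.single k 1 ∈ v.dom →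
          v.net p (x + Pi.single k 1) ≤ v.net p (x + Pi.single i 1) := by
        intro k hk
        have := le_argmax u k
        rw [← hi, hui] at this
        rwa [hu', v.utility_eq_coe p hk, WithBot.coe_le_coe] at this
      have himp : x ∈ v.dom → v.net p x < v.net p (x + Pi.single i 1) := by
        intro _
        rwa [hui, hux, WithBot.coe_lt_coe] at hlt
      obtain ⟨hI', hpot, hsum⟩ := hI.raise hmem (exists_demand_gt (hB.mNatConcave p)
        (le_scalingPoint l J e) hxi himp hbest hI.opt)
      exact Or.inr ⟨K, h, _, _, e, hI', hpot, fun h0 => ⟨rfl, h0, hsum⟩, key' _ (dif_neg hbot)⟩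

theorem HaltsWithin.mono [NeZero n] {s : ScalingState n} {N N' : ℕ} {x : Fin n → ℤ}
    (h : HaltsWithin v s N x) (hN : N ≤ N') : HaltsWithin v s N' x :=
  let ⟨m, hm, hx⟩ := h
  ⟨m, hm.trans hN, hx⟩

theorem haltsWithin_of_potential [NeZero n] (hB : B.Represents v) {p : Fin n → ℝ} (N : ℕ) {K : ℤ}
    {h l : Fin n → ℤ} {J : Finset (Fin n)} {e : Fin n → ℕ} (hI : ScalingInvariant v p K h l J e)
    (hN : scalingPotential h l J e < N) :
    ∃ x ∈ v.demand p, HaltsWithin v (.run p l J e) (N * (2 * n + 1)) x := by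
  induction N generalizing K h l J e with
  | zero => exact absurd hN (by simpa using scalingPotential_nonneg hI)
  | succ N ih =>
    rcases scalingBody_run hB hI with ⟨x, hx, hh⟩ | ⟨K', h', l', J', e', hI', hpot, -, hstep⟩
    · exact ⟨x, hx, hh.mono (Nat.le_mul_of_pos_left _ (Nat.succ_pos N))⟩
    · obtain ⟨x, hx, hh⟩ := ih hI' (by push_cast at hN; linarith)
      exact ⟨x, hx, (hstep _ _ hh).mono (Nat.succ_mul N _).ge⟩

/-- With unit steps only raises occur, each increasing the total of `l`, which never exceeds `K`.
For small bundles this beats the potential by a factor of order `n`. -/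
theorem haltsWithin_of_scale_one [NeZero n] (hB : B.Represents v) {p : Fin n → ℝ} (N : ℕ) {K : ℤ}
    {h l : Fin n → ℤ} {J : Finset (Fin n)} {e : Fin n → ℕ} (hI : ScalingInvariant v p K h l J e)
    (he : ∀ j, e j = 0) (hN : K < ∑ j, l j + N) :
    ∃ x ∈ v.demand p, HaltsWithin v (.run p l J e) (N * (2 * n + 1)) x := by
  induction N generalizing K h l J e with
  | zero =>
    obtain ⟨y, -, hly, hK⟩ := hI.opt
    have := Finset.sum_le_sum fun i (_ : i ∈ Finset.univ) => hly i
    simp at hN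
    omega
  | succ N ih =>
    rcases scalingBody_run hB hI with ⟨x, hx, hh⟩ | ⟨K', h', l', J', e', hI', -, h0, hstep⟩
    · exact ⟨x, hx, hh.mono (Nat.le_mul_of_pos_left _ (Nat.succ_pos N))⟩
    · obtain ⟨rfl, he', hl⟩ := h0 he
      obtain ⟨x, hx, hh⟩ := ih hI' he' (by push_cast at hN; omega)
      exact ⟨x, hx, (hstep _ _ hh).mono (Nat.succ_mul N _).ge⟩

end

/-! ### The initial scale and the number of queries. -/

section

variable {n : ℕ} {v : Valuation n} {B : BidList n}

theorem haltsWithin_search [NeZero n] {p : Fin n → ℝ} {L N : ℕ} {x : Fin n → ℤ}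
    (hL : ∀ i : Fin n, v.val (Pi.single i (4 * n * 2 ^ L)) = ⊥)
    (hlt : ∀ k < L, ¬ ∀ i : Fin n, v.val (Pi.single i (4 * n * 2 ^ k)) = ⊥)
    (h : HaltsWithin v (.run p 0 ∅ fun _ => L) N x) (j k : ℕ) (hjk : j + k = L) :
    HaltsWithin v (.search p k) (N + n * (j + 1)) x := by
  classical
  have key : ∀ (k : ℕ) (s : ScalingState n),
      (if ∀ i : Fin n, v.val (Pi.single i (4 * n * 2 ^ k)) = ⊥ then .run p 0 ∅ fun _ => k
        else .search p (k + 1)) = s →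
      ∀ N, HaltsWithin v s N x → HaltsWithin v (.search p k) (N + n) x := by
    rintro k s hs N ⟨m, hm, hx⟩
    refine ⟨m + n, by omega, Algorithm.HaltsFrom.compute (A := scalingAlgorithm n)
      (s' := scalingBody (.search p k)) rfl ?_⟩
    refine haltsFrom_askAll _ _ ?_
    subst hs
    exact hx
  induction j generalizing k with
  | zero =>
    obtain rfl : k = L := by omega
    have := key k _ (if_pos hL) N h
    simpa using this
  | succ j ih =>
    have := key k _ (if_neg (hlt k (by omega))) _ (ih (k + 1) (by omega))
    refine this.mono (le_of_eq ?_)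
    ring

theorem scalingAlgorithm_halts [NeZero n] (hB : B.Represents v) (p : Fin n → ℝ) :
    ∃ m x, (scalingAlgorithm n).Halts v p m x ∧ x ∈ v.demand p ∧
      ((∃ L : ℕ, m ≤ 19 * n ^ 3 * (L + 1) ∧ (n : ℤ) * 2 ^ (L + 1) ≤ B.numBids * B.maxWeight) ∨
        (m ≤ 7 * n ^ 2 ∧ (B.numBids : ℤ) * B.maxWeight < 2 * n)) := by
  classical
  have hn : 1 ≤ n := NeZero.one_le
  set W : ℤ := B.numBids * B.maxWeight with hW
  have hW0 : 0 ≤ W := mul_nonneg (by positivity) (hB.maxWeight_nonneg hn)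
  -- The factor `4 * n` makes a failed test at `L - 1` yield `n * 2 ^ (L + 1) ≤ W`, while each good
  -- contributes only `4 * n` to the initial potential.
  have hle : ∀ k : ℕ, (¬ ∀ i : Fin n, v.val (Pi.single i (4 * n * 2 ^ k)) = ⊥) →
      4 * n * 2 ^ k ≤ W := by
    intro k hk
    push Not at hk
    obtain ⟨i, hi⟩ := hk
    simpa using hB.sum_le hn hi
  have hex : ∃ k : ℕ, ∀ i : Fin n, v.val (Pi.single i (4 * n * 2 ^ k)) = ⊥ := by
    by_contra hne
    push Not at hne
    have h1 := hle W.toNat (by push Not; exact hne _)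
    have h2 : W.toNat < 2 ^ W.toNat := Nat.lt_two_pow_self
    have h3 : W < 2 ^ W.toNat := by
      have : ((W.toNat : ℕ) : ℤ) < 2 ^ W.toNat := by exact_mod_cast h2
      omega
    have h4 : (1 : ℤ) ≤ n := by exact_mod_cast hn
    nlinarith
  obtain ⟨L, hL, hmin⟩ : ∃ L : ℕ, (∀ i : Fin n, v.val (Pi.single i (4 * n * 2 ^ L)) = ⊥) ∧
      ∀ k < L, ¬ ∀ i : Fin n, v.val (Pi.single i (4 * n * 2 ^ k)) = ⊥ :=
    ⟨Nat.find hex, Nat.find_spec hex, fun k hk => Nat.find_min hex hk⟩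
  obtain ⟨y, hy⟩ := hB.demand_nonempty p
  have hyd := (v.mem_demand_iff.1 hy).1
  have hI : ScalingInvariant v p (∑ i, y i) (fun _ => 4 * n * 2 ^ L) 0 ∅ fun _ => L := by
    refine ⟨le_rfl, ?_, ⟨y, hy, v.nonneg_dom y hyd, le_rfl⟩, fun z hz _ _ i => ?_⟩
    · have : scalingPoint (0 : Fin n → ℤ) ∅ (fun _ => L) = 0 := by ext i; simp [scalingPoint]
      rw [this]
      exact hB.zero_mem
    · by_contra! hlt
      refine hB.mem_of_le hz (y := Pi.single i (4 * n * 2 ^ L)) ?_ ?_ (hL i)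
      · exact Pi.single_nonneg.2 (by positivity)
      · intro j
        by_cases hj : j = i
        · subst hj; simpa using hlt.le
        · simpa [hj] using v.nonneg_dom z hz j
  have hsearch : ∀ {N x}, HaltsWithin v (.run p 0 ∅ fun _ => L) N x →
      ∃ m ≤ N + n * (L + 1), (scalingAlgorithm n).Halts v p m x :=
    fun h => haltsWithin_search hL hmin h L 0 rfl
  by_cases hsmall : L = 0 ∧ W < 2 * n
  · obtain ⟨rfl, hW2⟩ := hsmall
    have hyW : ∑ i, y i ≤ W := hB.sum_le hn hyd
    obtain ⟨x, hx, hh⟩ := haltsWithin_of_scale_one hB (2 * n) hI (fun _ => rfl) (by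
      push_cast
      simp
      omega)
    obtain ⟨m, hm, hm'⟩ := hsearch hh
    refine ⟨m, x, hm', hx, Or.inr ⟨?_, hW2⟩⟩
    nlinarith
  · obtain ⟨x, hx, hh⟩ := haltsWithin_of_potential hB
      -- The initial potential: `4 * n` per good, `n` for the empty `J`, and the exponents; the last
      -- `1` makes the inequality strict.
      (4 * n ^ 2 + n + (3 * n + 3) * (n * L) + 1) hI (by
        have : (2 : ℝ) ^ L ≠ 0 := by positivity
        have e : ((4 * n * 2 ^ L : ℤ) : ℝ) / 2 ^ L = 4 * n := by
          push_cast; field_simp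
        simp only [scalingPotential, Pi.zero_apply, sub_zero, e]
        simp
        ring_nf
        linarith)
    obtain ⟨m, hm, hm'⟩ := hsearch hh
    refine ⟨m, x, hm', hx, Or.inl ⟨L, ?_, ?_⟩⟩
    · have h1 : n ≤ n ^ 2 := by nlinarith
      have h2 : 4 * n ^ 2 + n + (3 * n + 3) * (n * L) + 1 ≤ 6 * n ^ 2 * (L + 1) := by
        have : n * L ≤ n ^ 2 * L := Nat.mul_le_mul_right _ h1
        nlinarith
      have h3 : n * (L + 1) ≤ n ^ 3 * (L + 1) :=
        Nat.mul_le_mul_right _ (Nat.le_self_pow (by norm_num) n)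
      calc m ≤ (4 * n ^ 2 + n + (3 * n + 3) * (n * L) + 1) * (2 * n + 1) + n * (L + 1) := hm
        _ ≤ 6 * n ^ 2 * (L + 1) * (3 * n) + n ^ 3 * (L + 1) :=
          add_le_add (Nat.mul_le_mul h2 (by omega)) h3
        _ = 19 * n ^ 3 * (L + 1) := by ring
    · rcases L with _ | L
      · simp at hsmall ⊢
        linarith
      · have := hle L (hmin L (Nat.lt_succ_self L))
        calc (n : ℤ) * 2 ^ (L + 1 + 1) = 4 * n * 2 ^ L := by ring
          _ ≤ W := this

theorem le_log_of_halts {m n L : ℕ} {R : ℝ} (hR : 2 ^ (L + 1) ≤ R)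
    (hm : m ≤ 19 * n ^ 3 * (L + 1)) : (m : ℝ) ≤ 100 * ((n : ℝ) ^ 3 * Real.log R) := by
  have h1 : ((L + 1 : ℕ) : ℝ) * Real.log 2 ≤ Real.log R := by
    rw [← Real.log_pow]
    exact Real.log_le_log (by positivity) hR
  have h2 := Real.log_two_gt_d9
  have hm' : (m : ℝ) ≤ 19 * (n : ℝ) ^ 3 * (L + 1) := by exact_mod_cast hm
  have h3 : (L + 1 : ℝ) ≤ 2 * Real.log R := by
    push_cast at h1
    have : (0 : ℝ) ≤ L := by positivity
    nlinarith
  have h4 : (0 : ℝ) ≤ (n : ℝ) ^ 3 := by positivity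
  have h5 : (0 : ℝ) ≤ Real.log R := by
    have : (0 : ℝ) ≤ L := by positivity
    linarith
  have h6 := mul_le_mul_of_nonneg_left h3 h4
  have h7 := mul_nonneg h4 h5
  nlinarith

end

end SSDemand

end

/-! ### The absolute constant. -/

theorem mainTheorem5 :
    ∃ C : ℝ, 0 < C ∧ ∀ n : ℕ, 1 ≤ n →
      (∀ (p : Fin n → ℝ) (v : SSDemand.Valuation n) (B : SSDemand.BidList n),
        v.StrongSubstitutes → B.Represents v →
          ∃ (m : ℕ) (x : Fin n → ℤ),
            (SSDemand.steepestAscent n).Halts v p m x ∧ x ∈ v.demand p ∧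
            (B.support.Nonempty →
              (m : ℝ) ≤ C * ((n : ℝ) ^ 2 * ((B.numBids : ℝ) * (B.maxWeight : ℝ))))) ∧
      (∃ A : SSDemand.Algorithm n,
        ∀ (p : Fin n → ℝ) (v : SSDemand.Valuation n) (B : SSDemand.BidList n),
          v.StrongSubstitutes → B.Represents v →
            ∃ (m : ℕ) (x : Fin n → ℤ),
              A.Halts v p m x ∧ x ∈ v.demand p ∧
              (m : ℝ) ≤ C * ((n : ℝ) ^ 3 *
                Real.log (2 + (B.numBids : ℝ) * (B.maxWeight : ℝ) / (n : ℝ))) ∧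
              ((n : ℝ) < (B.numBids : ℝ) * (B.maxWeight : ℝ) →
                (m : ℝ) ≤ C * ((n : ℝ) ^ 3 *
                  Real.log ((B.numBids : ℝ) * (B.maxWeight : ℝ) / (n : ℝ))))) := by
  refine ⟨100, by norm_num, fun n hn => ⟨fun p v B _ hB => ?_, ?_⟩⟩
  · obtain ⟨m, x, hh, hx, hm⟩ := SSDemand.steepestAscent_halts hB hn p
    refine ⟨m, x, hh, hx, fun hne => ?_⟩
    have hW : (1 : ℤ) ≤ B.numBids * B.maxWeight := by
      have h1 := hB.maxWeight_pos hn hne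
      have h2 : (1 : ℤ) ≤ B.numBids := by exact_mod_cast hne.card_pos
      nlinarith
    have hm' : (m : ℝ) ≤ ((B.numBids : ℝ) * B.maxWeight + 1) * (n + 1) ^ 2 + 1 := by
      exact_mod_cast hm
    have hW' : (1 : ℝ) ≤ (B.numBids : ℝ) * B.maxWeight := by exact_mod_cast hW
    have hn' : (1 : ℝ) ≤ n := by exact_mod_cast hn
    generalize (B.numBids : ℝ) * B.maxWeight = W at *
    have h1 : ((n : ℝ) + 1) ^ 2 ≤ 4 * n ^ 2 := by nlinarith
    have h2 : (W + 1) * ((n : ℝ) + 1) ^ 2 ≤ 2 * W * (4 * n ^ 2) :=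
      mul_le_mul (by linarith) h1 (by positivity) (by linarith)
    have h3 : 1 ≤ (n : ℝ) ^ 2 * W := by nlinarith
    nlinarith
  · have : NeZero n := ⟨by omega⟩
    refine ⟨SSDemand.scalingAlgorithm n, fun p v B _ hB => ?_⟩
    obtain ⟨m, x, hh, hx, hm⟩ := SSDemand.scalingAlgorithm_halts hB p
    refine ⟨m, x, hh, hx, ?_⟩
    have hW0 : (0 : ℤ) ≤ B.numBids * B.maxWeight :=
      mul_nonneg (by positivity) (hB.maxWeight_nonneg hn)
    have hW0' : (0 : ℝ) ≤ (B.numBids : ℝ) * B.maxWeight := by exact_mod_cast hW0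
    have hn' : (0 : ℝ) < n := by exact_mod_cast hn
    rcases hm with ⟨L, hm, hL⟩ | ⟨hm, hW⟩
    · have hL' : (n : ℝ) * 2 ^ (L + 1) ≤ (B.numBids : ℝ) * B.maxWeight := by exact_mod_cast hL
      have hR : (2 : ℝ) ^ (L + 1) ≤ (B.numBids : ℝ) * B.maxWeight / n := by
        rw [le_div_iff₀ hn']
        linarith
      exact ⟨SSDemand.le_log_of_halts (by linarith) hm, fun _ => SSDemand.le_log_of_halts hR hm⟩
    · have hm' : (m : ℝ) ≤ 7 * (n : ℝ) ^ 2 := by exact_mod_cast hm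
      refine ⟨?_, fun hlt => ?_⟩
      · have h1 : Real.log 2 ≤ Real.log (2 + (B.numBids : ℝ) * B.maxWeight / n) :=
          Real.log_le_log (by norm_num) (by have := div_nonneg hW0' hn'.le; linarith)
        have h2 := Real.log_two_gt_d9
        have h3 : (n : ℝ) ^ 2 ≤ (n : ℝ) ^ 3 :=
          pow_le_pow_right₀ (by exact_mod_cast hn) (by norm_num)
        have h4 : (n : ℝ) ^ 3 * (1 / 2) ≤
            (n : ℝ) ^ 3 * Real.log (2 + (B.numBids : ℝ) * B.maxWeight / n) :=
          mul_le_mul_of_nonneg_left (by linarith) (by positivity)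
        have h5 : (0 : ℝ) ≤ (n : ℝ) ^ 3 := by positivity
        linarith
      -- By integrality `B * W ≥ n + 1`, so `log (B * W / n) ≥ 1 - n / (n + 1) ≥ 1 / (2 * n)`. Times
      -- `n ^ 3`, this pays for the `7 * n ^ 2` queries of the unit-step case.
      · have hlt' : (n : ℤ) < B.numBids * B.maxWeight := by exact_mod_cast hlt
        have h1 : (n : ℝ) + 1 ≤ (B.numBids : ℝ) * B.maxWeight := by exact_mod_cast hlt'
        have h2 : (B.numBids : ℝ) * B.maxWeight ≤ 2 * n := by exact_mod_cast hW.le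
        generalize (B.numBids : ℝ) * B.maxWeight = W at *
        have hWpos : 0 < W := by linarith
        have h3 := Real.one_sub_inv_le_log_of_pos (div_pos hWpos hn')
        have h4 : 1 / (2 * n) ≤ 1 - (W / n)⁻¹ := by
          rw [inv_div, div_le_iff₀ (by positivity), sub_mul, div_mul_eq_mul_div, le_sub_iff_add_le,
            one_mul, ← le_sub_iff_add_le', div_le_iff₀ hWpos]
          nlinarith
        have h5 : (n : ℝ) ^ 3 * (1 / (2 * n)) ≤ (n : ℝ) ^ 3 * Real.log (W / n) :=
          mul_le_mul_of_nonneg_left (h4.trans h3) (by positivity)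
        have h6 : (n : ℝ) ^ 3 * (1 / (2 * n)) = (n : ℝ) ^ 2 / 2 := by field_simp
        have h7 : (0 : ℝ) ≤ (n : ℝ) ^ 2 := by positivity
        linarith
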